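/- Let $K$ be a field of characteristic $0$ (for instance $\mathbb{C}$). A strict partition is a sequence of integers $\lambda_1>\lambda_2>\cdots>\lambda_\ell\ge 0$; its length $\ell(\lambda)=\ell$ counts a part $0$. **Lattice models.** A vertex has spins in $\{+,-\}$ on its (left, top, right, bottom) edges. In row $i$ of the model $\overline{\mathfrak S}$ the admissible vertices and their weights are $a_1^{(i)}:(+,+,+,+)$, $a_2^{(i)}:(-,-,-,-)$, $b_1^{(i)}:(+,-,+,-)$, $b_2^{(i)}:(-,+,-,+)$, $c_1^{(i)}:(-,+,+,-)$, $c_2^{(i)}:(+,-,-,+)$; in the dual model $\overline{\mathfrak S}^*$ they are the same except that $c_1^{(i)}:(+,+,-,-)$ and $c_2^{(i)}:(-,-,+,+)$. All other vertices have weight $0$. For $N\ge 0$, strict partitions $\lambda,\mu$ and $M\ge\max(\lambda_1,\mu_1)$, the model $\overline{\mathfrak S}_{\lambda/\mu}$ is the grid with $N$ rows, numbered $1,\dots,N$ from bottom to top, and columns $0,\dots,M$ from left to right, with all left and right boundary spins $+$, bottom boundary spins $-$ exactly on the parts of $\lambda$, and top boundary spins $-$ exactly on the parts of $\mu$. In $\overline{\mathfrak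 S}^*_{\lambda/\mu}$ the rows are numbered from top to bottom, $\lambda$ is at the top and $\mu$ at the bottom. The partition function $Z$ is the sum over all states of the product of the vertex weights. The weights are free fermionic if $a_1^{(i)}a_2^{(i)}+b_1^{(i)}b_2^{(i)}=c_1^{(i)}c_2^{(i)}$ for all $i$. For sequences $x_i,y_i,A_i,B_i\in K$ $(i\ge 1)$, $\mathfrak S$ is the model $\overline{\mathfrak S}$ with $$(a_1,a_2,b_1,b_2,c_1,c_2)^{(i)}=(A_i,\;y_iA_iB_i,\;A_iB_i,\;x_iA_i,\;(x_i+y_i)A_iB_i,\;A_i),$$ and, for $A_i,B_i\neq 0$, $\mathfrak S^*$ is the model $\overline{\mathfrak S}^*$ with $$(a_1,a_2,b_1,b_2,c_1,c_2)^{(i)}=(A_i^{-1},\;x_iA_i^{-1}B_i^{-1},\;A_i^{-1}B_i^{-1},\;y_iA_i^{-1},\;(x_i+y_i)A_i^{-1},\;A_i^{-1}B_i^{-1}).$$ **Hamiltonians.** Let $\psi^*_p,\psi_p$ $(p\in\mathbb Z+\tfrac12)$ be the creation and annihilation operators on fermionic Fock space over $K$, whose vacuum $|0\rangle$ has exactly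 the negative positions occupied; put $|\lambda\rangle=\psi^*_{\lambda_1+1/2}\cdots\psi^*_{\lambda_\ell+1/2}|0\rangle$, let $\langle\lambda|=\langle 0|\psi_{\lambda_\ell+1/2}\cdots\psi_{\lambda_1+1/2}$ be the dual vector, and $J_n=\sum_i{:}\psi^*_{i-n}\psi_i{:}$. For parameters $s_k^{(j)}\in K$ $(j\ge1,\ k\in\mathbb Z\setminus\{0\})$ let $H_\pm=\sum_{k\ge1}\sum_{j=1}^N s_{\pm k}^{(j)}J_{\pm k}$. Consider the conditions $$(\ast)\quad Z(\overline{\mathfrak S}_{\lambda/\mu})=C(N,M,\ell(\lambda))\,\langle\mu|e^{H_+}|\lambda\rangle,\qquad(\ast\ast)\quad Z(\overline{\mathfrak S}^*_{\lambda/\mu})=C(N,M,\ell(\lambda))\,\langle\lambda|e^{H_-}|\mu\rangle,$$ each for all strict partitions $\lambda,\mu$, all $N\ge0$ and all $M\ge\max(\lambda_1,\mu_1)$. Then: 1. (a) If $s_k^{(j)}=\frac1k\left(x_j^k+(-1)^{k-1}y_j^k\right)$ for all $k,j\ge1$, then $\mathfrak S$ satisfies $(\ast)$ with $C=\prod_{i=1}^N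 A_i^{M+1}B_i^{\ell(\lambda)}$. If all $A_i,B_i$ are nonzero, then, conversely, $(\ast)$ with this $C$ forces these values of $s_k^{(j)}$. (b) Suppose that $c_1^{(i)},c_2^{(i)}\ne0$ for all $i$. If the weights of $\overline{\mathfrak S}$ are not free fermionic, then $(\ast)$ does not hold for any choice of the $s_k^{(j)}$ and of $C$. If moreover $a_1^{(i)},b_1^{(i)}\neq0$ for all $i$, then $(\ast)$ holds for some choice of the $s_k^{(j)}$ and $C$ if and only if the weights are free fermionic. 2. (a) If all $A_i,B_i$ are nonzero, then $\mathfrak S^*$ satisfies $(\ast\ast)$ with $C=\prod_{i=1}^N A_i^{-(M+1)}B_i^{-\ell(\lambda)}$ if and only if $s_{-k}^{(j)}=\frac1k\left(y_j^k+(-1)^{k-1}x_j^k\right)$ for all $k,j\ge1$. (b) The statement of 1(b) holds for $\overline{\mathfrak S}^*$, $(\ast\ast)$ and the $s_{-k}^{(j)}$. -/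

import Mathlib

noncomputable section

namespace SixVertex

/-! ### Strict partitions -/

/-- A strict partition `λ₁ > λ₂ > ⋯ > λ_ℓ ≥ 0` is given by its finite set of parts. The part `0` is
allowed and counts for the length, so the length `ℓ(λ)` is the cardinality. -/
abbrev StrictPartition : Type := Finset ℕ

/-! ### Six-vertex models -/

/-- The spins on the edges; a `minus` is a particle. -/
inductive Spin : Type
  | plus
  | minus
  deriving DecidableEq

instance : Fintype Spin where
  elems := {Spin.plus, Spin.minus}
  complete := by intro s; cases s <;> simp

/-- The six Boltzmann weights of one row. -/
structure Weights (K : Type*) where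
  a₁ : K
  a₂ : K
  b₁ : K
  b₂ : K
  c₁ : K
  c₂ : K

/-- The free fermion condition for the weights of one row. -/
def Weights.FreeFermionic {K : Type*} [Field K] (w : Weights K) : Prop :=
  w.a₁ * w.a₂ + w.b₁ * w.b₂ = w.c₁ * w.c₂

open Spin in
/-- Weight of a vertex of the model `𝔖`, as a function of the spins on its left, top, right and
bottom edges (in this order); non-admissible vertices have weight `0`. -/
def Weights.vertex {K : Type*} [Field K] (w : Weights K) : Spin → Spin → Spin → Spin → K
  | plus, plus, plus, plus => w.a₁
  | minus, minus, minus, minus => w.a₂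
  | plus, minus, plus, minus => w.b₁
  | minus, plus, minus, plus => w.b₂
  | minus, plus, plus, minus => w.c₁
  | plus, minus, minus, plus => w.c₂
  | _, _, _, _ => 0

open Spin in
/-- Weight of a vertex of the dual model `𝔖*` (left, top, right, bottom). -/
def Weights.dualVertex {K : Type*} [Field K] (w : Weights K) : Spin → Spin → Spin → Spin → K
  | plus, plus, plus, plus => w.a₁
  | minus, minus, minus, minus => w.a₂
  | plus, minus, plus, minus => w.b₁
  | minus, plus, minus, plus => w.b₂
  | plus, plus, minus, minus => w.c₁
  | minus, minus, plus, plus => w.c₂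
  | _, _, _, _ => 0

/-- The boundary spins on columns `0, …, M` with `-` exactly on the parts of `lam`. -/
def boundary (M : ℕ) (lam : StrictPartition) (c : Fin (M + 1)) : Spin :=
  if (c : ℕ) ∈ lam then Spin.minus else Spin.plus

/-- Partition function of the model `𝔖_{λ/μ}` with arbitrary row weights, `N` rows (numbered from
bottom to top) and columns `0, …, M` (from left to right). The spins of a state are `v` on the
vertical edges (`v 0` is the bottom boundary `λ`, `v N` the top boundary `μ`) and `h` on the
horizontal edges (`h i 0` and `h i (M + 1)` are the left and right boundary edges, both `+`).
`W i` holds the weights of the `(i+1)`-st row. -/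
def Z {K : Type*} [Field K] (W : ℕ → Weights K) (N M : ℕ) (lam mu : StrictPartition) : K :=
  ∑ v : Fin (N + 1) → Fin (M + 1) → Spin, ∑ h : Fin N → Fin (M + 2) → Spin,
    if v 0 = boundary M lam ∧ v (Fin.last N) = boundary M mu ∧
        ∀ i, h i 0 = Spin.plus ∧ h i (Fin.last (M + 1)) = Spin.plus then
      ∏ i : Fin N, ∏ c : Fin (M + 1),
        (W i).vertex (h i c.castSucc) (v i.succ c) (h i c.succ) (v i.castSucc c)
    else 0

/-- Partition function of the dual model `𝔖*_{λ/μ}`. Here the rows are numbered from top to bottom: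
`v 0` is the top boundary `λ` and `v N` the bottom boundary `μ`. -/
def dualZ {K : Type*} [Field K] (W : ℕ → Weights K) (N M : ℕ) (lam mu : StrictPartition) : K :=
  ∑ v : Fin (N + 1) → Fin (M + 1) → Spin, ∑ h : Fin N → Fin (M + 2) → Spin,
    if v 0 = boundary M lam ∧ v (Fin.last N) = boundary M mu ∧
        ∀ i, h i 0 = Spin.plus ∧ h i (Fin.last (M + 1)) = Spin.plus then
      ∏ i : Fin N, ∏ c : Fin (M + 1),
        (W i).dualVertex (h i c.castSucc) (v i.castSucc c) (h i c.succ) (v i.succ c)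
    else 0

/-- The weights of `𝔖(x, y, A, B)`. -/
def weights {K : Type*} [Field K] (x y A B : ℕ → K) (i : ℕ) : Weights K where
  a₁ := A i
  a₂ := y i * A i * B i
  b₁ := A i * B i
  b₂ := x i * A i
  c₁ := (x i + y i) * A i * B i
  c₂ := A i

/-- The weights of `𝔖*(x, y, A, B)`. -/
def dualWeights {K : Type*} [Field K] (x y A B : ℕ → K) (i : ℕ) : Weights K where
  a₁ := (A i)⁻¹
  a₂ := x i * (A i)⁻¹ * (B i)⁻¹
  b₁ := (A i)⁻¹ * (B i)⁻¹
  b₂ := y i * (A i)⁻¹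
  c₁ := (x i + y i) * (A i)⁻¹
  c₂ := (A i)⁻¹ * (B i)⁻¹

/-! ### Classical fermionic Fock space

The fermion modes are labelled by integers: the integer `p` stands for the half-integer `p + 1/2`.
Fock space is realised as the semi-infinite wedge space, `ψ*_p` being the wedge product with `v_p`
and `ψ_p` the contraction. -/

/-- A particle configuration: a set of occupied positions which differs from the set of negative
positions only finitely. It stands for the semi-infinite wedge `v_{p₁} ∧ v_{p₂} ∧ ⋯` of its elements
`p₁ > p₂ > ⋯`. -/
@[ext]
structure Maya where
  occ : Set ℤ
  finite_symmDiff : (symmDiff occ (Set.Iio 0)).Finite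

namespace Maya

/-- The vacuum: exactly the negative positions are occupied. -/
def vacuum : Maya where
  occ := Set.Iio 0
  finite_symmDiff := by simp

/-- Add a particle at `p`. -/
def insert (S : Maya) (p : ℤ) : Maya where
  occ := Insert.insert p S.occ
  finite_symmDiff := by
    refine (S.finite_symmDiff.union (Set.finite_singleton p)).subset ?_
    intro q hq
    simp only [Set.mem_symmDiff, Set.mem_insert_iff, Set.mem_union, Set.mem_singleton_iff] at hq ⊢
    tauto

/-- Remove the particle at `p`. -/
def erase (S : Maya) (p : ℤ) : Maya where
  occ := S.occ \ {p}
  finite_symmDiff := by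
    refine (S.finite_symmDiff.union (Set.finite_singleton p)).subset ?_
    intro q hq
    simp only [Set.mem_symmDiff, Set.mem_sdiff, Set.mem_union, Set.mem_singleton_iff] at hq ⊢
    tauto

/-- The sign of moving `v_p` past the particles to the right of position `p`. -/
def sign (K : Type*) [Field K] (S : Maya) (p : ℤ) : K :=
  (-1) ^ {q : ℤ | q ∈ S.occ ∧ p < q}.ncard

end Maya

/-- Fock space, with the particle configurations as basis. -/
abbrev Fock (K : Type*) [Field K] : Type _ := Maya →₀ K

variable (K : Type*) [Field K]

/-- The vacuum vector `|0⟩`. -/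
def vac : Fock K := Finsupp.single Maya.vacuum 1

open Classical in
/-- The creation operator `ψ*_p`. -/
def psiStar (p : ℤ) : Module.End K (Fock K) :=
  Finsupp.linearCombination K fun S : Maya =>
    if p ∈ S.occ then 0 else Finsupp.single (S.insert p) (S.sign K p)

open Classical in
/-- The annihilation operator `ψ_p`. -/
def psi (p : ℤ) : Module.End K (Fock K) :=
  Finsupp.linearCombination K fun S : Maya =>
    if p ∈ S.occ then Finsupp.single (S.erase p) (S.sign K p) else 0

/-- The vacuum expectation value `⟨X⟩ = ⟨0|X|0⟩`. -/
def vacuumExpectation (X : Module.End K (Fock K)) : K := X (vac K) Maya.vacuum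

/-- The normally ordered product `:ψ*_j ψ_i: = ψ*_j ψ_i - ⟨ψ*_j ψ_i⟩`. -/
def normalOrdered (j i : ℤ) : Module.End K (Fock K) :=
  psiStar K j * psi K i - vacuumExpectation K (psiStar K j * psi K i) • 1

/-- The current operator `J_n = ∑_i :ψ*_{i-n} ψ_i:`, where on each basis vector only finitely many
terms are nonzero. -/
def current (n : ℤ) : Module.End K (Fock K) :=
  Finsupp.linearCombination K fun S : Maya =>
    ∑ᶠ i : ℤ, normalOrdered K (i - n) i (Finsupp.single S 1)

/-- `|λ⟩ = ψ*_{λ₁} ψ*_{λ₂} ⋯ ψ*_{λ_ℓ} |0⟩`. -/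
def ket (lam : StrictPartition) : Fock K :=
  ((lam.sort (· ≥ ·)).map fun p : ℕ => psiStar K (p : ℤ)).prod (vac K)

/-- `⟨λ|v⟩ = ⟨0| ψ_{λ_ℓ} ⋯ ψ_{λ₂} ψ_{λ₁} v`. -/
def bra (lam : StrictPartition) (v : Fock K) : K :=
  ((lam.sort (· ≤ ·)).map fun p : ℕ => psi K (p : ℤ)).prod v Maya.vacuum

variable {K}

/-- The matrix element `⟨α| e^H |β⟩ = ∑_m ⟨α| H^m |β⟩ / m!` for `H = ∑_{k ≥ 1} t_k J_k`
(if `ε = 1`) or `H = ∑_{k ≥ 1} t_k J_{-k}` (if `ε = -1`), with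
`⟨α| H^m |β⟩ = ∑_{k₁, …, k_m ≥ 1} t_{k₁} ⋯ t_{k_m} ⟨α| J_{εk₁} ⋯ J_{εk_m} |β⟩`. As `J_n` lowers the
energy by `n`, only finitely many terms of the sums are nonzero, for both signs. -/
def expElement (ε : ℤ) (t : ℕ+ → K) (α β : StrictPartition) : K :=
  ∑ᶠ m : ℕ, ((m.factorial : K))⁻¹ *
    ∑ᶠ k : Fin m → ℕ+, (∏ i, t (k i)) *
      bra K α ((List.ofFn fun i => current K (ε * (k i : ℤ))).prod (ket K β))

/-- `⟨α| e^{H₊} |β⟩` for `H₊ = ∑_{k ≥ 1} s_k J_k`, `s_k = ∑_{j=1}^N s_k^{(j)}`. Here `s j k` is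
`s_k^{(j+1)}`, for `k ∈ ℤ \ {0}`. -/
def expPlus (s : ℕ → ℤ → K) (N : ℕ) (α β : StrictPartition) : K :=
  expElement 1 (fun k => ∑ j ∈ Finset.range N, s j (k : ℤ)) α β

/-- `⟨α| e^{H₋} |β⟩` for `H₋ = ∑_{k ≥ 1} s_{-k} J_{-k}`, `s_{-k} = ∑_{j=1}^N s_{-k}^{(j)}`. -/
def expMinus (s : ℕ → ℤ → K) (N : ℕ) (α β : StrictPartition) : K :=
  expElement (-1) (fun k => ∑ j ∈ Finset.range N, s j (-(k : ℤ))) α β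

/-! ### Matching -/

/-- The model with row weights `W` matches `e^{H₊}` with extra factor `C N M ℓ(λ)`, for all strict
partitions `λ, μ`, all `N`, and all `M ≥ max(λ₁, μ₁)`. -/
def Matches (W : ℕ → Weights K) (s : ℕ → ℤ → K) (C : ℕ → ℕ → ℕ → K) : Prop :=
  ∀ (N M : ℕ) (lam mu : StrictPartition), (∀ p ∈ lam, p ≤ M) → (∀ p ∈ mu, p ≤ M) →
    Z W N M lam mu = C N M lam.card * expPlus s N mu lam

/-- The dual model with row weights `W` matches `e^{H₋}` with extra factor `C N M ℓ(λ)`. -/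
def DualMatches (W : ℕ → Weights K) (s : ℕ → ℤ → K) (C : ℕ → ℕ → ℕ → K) : Prop :=
  ∀ (N M : ℕ) (lam mu : StrictPartition), (∀ p ∈ lam, p ≤ M) → (∀ p ∈ mu, p ≤ M) →
    dualZ W N M lam mu = C N M lam.card * expMinus s N lam mu

/-- The factor `∏_{i=1}^N A_i^{M+1} B_i^ℓ`. -/
def factor (A B : ℕ → K) (N M l : ℕ) : K :=
  ∏ i ∈ Finset.range N, A i ^ (M + 1) * B i ^ l

end SixVertex

end

/-! Work with wedges of v_0, v_1, … and put v_{-1} = 0. For k ≥ 1 the current J_k acts as the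
derivation with v_q ↦ v_{q-k}, so for one row e^{H₊} applies exp(∑ s_k z^k) = (1 + yz)/(1 - xz) to
every factor, where z is the shift v_q ↦ v_{q-1}. It therefore fixes the vacuum and carries the
wedge product with v_p - x v_{p-1} to that with v_p + y v_{p-1}. These two properties determine an
operator (`eq_zero_of_mul_createPair`), and the transfer operator of a row with A = B = 1 has them
(`intertwines_rowOp`): by `Intertwines.of_max` it suffices to let p lie above all particles, where
only the last two columns matter.

The comparison with the exponential goes through the diagonal weight operator L. An intertwiner T
commutes with every `ham t` and satisfies [T, L] = `ham` (x^k - (-y)^k) T. Hence a product G of row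
operators satisfies [G, L] = `ham` (k t_k) G, an equation that e^H satisfies as well. In
characteristic 0 its unitriangular solution is unique (`eq_expVec`).

The factors A and B split off because a row has one A per column and one B per particle, and
particles are conserved. The dual model is a reflection of the first one with c₁ and c₂ exchanged;
partition functions only see the product c₁c₂, and J_{-k} is adjoint to J_k (`expElement_neg_one`).

For the converse, the amplitude for one particle to go from n to 0 is t_n plus a polynomial in the
lower parameters, so the parameters are unique. For arbitrary weights, three amplitudes on three
columns express h₁, h₂, e₂ of the parameters, and the identity h₁² = h₂ + e₂ becomes the free
fermion condition (`ExpMatches.freeFermionic`). Conversely, free fermionic weights with a₁, b₁ ≠ 0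
agree with some 𝔖(x, y, A, B) up to rescaling c₁ and c₂ (`exists_expMatches`). -/

noncomputable section

namespace SixVertex

/-! ### The finite wedge space -/

/-- Finite wedges of the basis vectors `v_0, v_1, …`, with the finite sets as basis. -/
def FinWedge (K : Type*) [Field K] : Type _ := Finset ℕ →₀ K

section FinWedge

variable {K : Type*} [Field K]

instance : AddCommGroup (FinWedge K) := inferInstanceAs (AddCommGroup (Finset ℕ →₀ K))

instance : Module K (FinWedge K) := inferInstanceAs (Module K (Finset ℕ →₀ K))

/-- The basis vector of `FinWedge K` indexed by `S`. -/
def wedge (K : Type*) [Field K] (S : Finset ℕ) : FinWedge K :=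
  (Finsupp.single S 1 : Finset ℕ →₀ K)

/-- The coefficient of `wedge K S`. -/
def coeff (S : Finset ℕ) : FinWedge K →ₗ[K] K := Finsupp.lapply (R := K) S

/-- The linear map with given values on the basis. -/
def lift {M : Type*} [AddCommGroup M] [Module K M] (f : Finset ℕ → M) : FinWedge K →ₗ[K] M :=
  Finsupp.linearCombination K f

theorem lift_wedge {M : Type*} [AddCommGroup M] [Module K M] (f : Finset ℕ → M)
    (S : Finset ℕ) : lift f (wedge K S) = f S :=
  (Finsupp.linearCombination_single K 1 S).trans (one_smul K _)

theorem coeff_wedge (S T : Finset ℕ) : coeff S (wedge K T) = if T = S then 1 else 0 :=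
  Finsupp.single_apply

theorem hom_ext {M : Type*} [AddCommGroup M] [Module K M] {X Y : FinWedge K →ₗ[K] M}
    (h : ∀ S, X (wedge K S) = Y (wedge K S)) : X = Y :=
  Finsupp.lhom_ext' fun S => LinearMap.ext_ring (h S)

theorem coeff_ext {u v : FinWedge K} (h : ∀ S, coeff S u = coeff S v) : u = v :=
  Finsupp.ext h

/-- The sign of moving `v_p` past the elements of `S` above `p`. -/
def wedgeSign (K : Type*) [Field K] (S : Finset ℕ) (p : ℕ) : K :=
  (-1) ^ (S.filter (p < ·)).card

/-- Wedge product with `v_p`. -/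
def create (K : Type*) [Field K] (p : ℕ) : Module.End K (FinWedge K) :=
  lift fun S =>
    if p ∈ S then 0 else wedgeSign K S p • wedge K (insert p S)

/-- Contraction with `v_p`. -/
def annihilate (K : Type*) [Field K] (p : ℕ) : Module.End K (FinWedge K) :=
  lift fun S =>
    if p ∈ S then wedgeSign K S p • wedge K (S.erase p) else 0

theorem create_wedge (p : ℕ) (S : Finset ℕ) :
    create K p (wedge K S) = if p ∈ S then 0 else wedgeSign K S p • wedge K (insert p S) :=
  lift_wedge _ _

theorem annihilate_wedge (p : ℕ) (S : Finset ℕ) :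
    annihilate K p (wedge K S) = if p ∈ S then wedgeSign K S p • wedge K (S.erase p) else 0 :=
  lift_wedge _ _

/-! ### Signs and anticommutation relations. -/

theorem wedgeSign_insert {S : Finset ℕ} {q : ℕ} (hq : q ∉ S) (p : ℕ) :
    wedgeSign K (insert q S) p = if p < q then -wedgeSign K S p else wedgeSign K S p := by
  unfold wedgeSign
  rw [Finset.filter_insert]
  split_ifs with h
  · rw [Finset.card_insert_of_notMem (by simp [hq]), pow_succ]; ring
  · rfl

theorem wedgeSign_erase {S : Finset ℕ} {q : ℕ} (hq : q ∈ S) (p : ℕ) :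
    wedgeSign K (S.erase q) p = if p < q then -wedgeSign K S p else wedgeSign K S p := by
  have := wedgeSign_insert (K := K) (Finset.notMem_erase q S) p
  rw [Finset.insert_erase hq] at this
  split_ifs at this ⊢ <;> rw [this]
  simp

theorem wedgeSign_mul_self (S : Finset ℕ) (p : ℕ) : wedgeSign K S p * wedgeSign K S p = 1 := by
  unfold wedgeSign
  rw [← mul_pow]; simp

theorem create_mul_create (p q : ℕ) : create K p * create K q = -(create K q * create K p) := by
  refine hom_ext fun S => ?_
  simp only [Module.End.mul_apply, LinearMap.neg_apply, create_wedge]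
  by_cases hp : p ∈ S
  · by_cases hq : q ∈ S
    · simp [hp, hq]
    · simp [hp, hq, create_wedge]
  · by_cases hq : q ∈ S
    · simp [hp, hq, create_wedge]
    · rcases lt_trichotomy p q with h | rfl | h
      · simp [hp, hq, create_wedge, h.ne, h.ne', wedgeSign_insert, h, h.le, Finset.insert_comm p q,
          smul_smul, mul_comm]
      · simp [hp, create_wedge]
      · simp [hp, hq, create_wedge, h.ne, h.ne', wedgeSign_insert, h, h.le, Finset.insert_comm p q,
          smul_smul, mul_comm]

theorem annihilate_mul_create (p q : ℕ) :
    annihilate K p * create K q = (if p = q then 1 else 0) - create K q * annihilate K p := by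
  refine hom_ext fun S => ?_
  by_cases hpq : p = q
  · subst hpq
    simp only [Module.End.mul_apply, LinearMap.sub_apply, create_wedge, annihilate_wedge]
    by_cases hp : p ∈ S
    · simp [hp, create_wedge, wedgeSign_erase, smul_smul, wedgeSign_mul_self]
    · simp [hp, annihilate_wedge, wedgeSign_insert, smul_smul, wedgeSign_mul_self]
  · simp only [Module.End.mul_apply, LinearMap.sub_apply, create_wedge, annihilate_wedge]
    by_cases hp : p ∈ S
    · by_cases hq : q ∈ S
      · simp [hp, hq, hpq, Ne.symm hpq, create_wedge]
      · have hpq' : q ≠ p := Ne.symm hpq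
        have he : (insert q S).erase p = insert q (S.erase p) := Finset.erase_insert_of_ne hpq'
        rcases lt_or_gt_of_ne hpq with h | h
        · simp [hp, hq, hpq, create_wedge, annihilate_wedge, wedgeSign_insert, wedgeSign_erase,
            he, h, h.le, smul_smul, mul_comm]
        · simp [hp, hq, hpq, create_wedge, annihilate_wedge, wedgeSign_insert, wedgeSign_erase,
            he, h, h.le, smul_smul, mul_comm]
    · by_cases hq : q ∈ S
      · simp [hp, hq, hpq]
      · simp [hp, hq, hpq, annihilate_wedge]

/-- The creation operators with the index shifted by one, so that `v_{-1} = 0`. -/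
def shiftedCreate (K : Type*) [Field K] : ℕ → Module.End K (FinWedge K)
  | 0 => 0
  | p + 1 => create K p

theorem shiftedCreate_mul (p q : ℕ) :
    shiftedCreate K p * shiftedCreate K q = -(shiftedCreate K q * shiftedCreate K p) := by
  cases p <;> cases q <;> simp [shiftedCreate]
  exact create_mul_create _ _

/-- The weight `∑ (p + 1)` of a finite set. -/
def wt (S : Finset ℕ) : ℕ := ∑ p ∈ S, (p + 1)

/-- The weight as a diagonal operator. -/
def weightOp (K : Type*) [Field K] : Module.End K (FinWedge K) :=
  lift fun S => (wt S : K) • wedge K S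

theorem weightOp_wedge (S : Finset ℕ) : weightOp K (wedge K S) = (wt S : K) • wedge K S :=
  lift_wedge _ _

theorem coeff_weightOp (S : Finset ℕ) (v : FinWedge K) :
    coeff S (weightOp K v) = wt S * coeff S v := by
  have : coeff S ∘ₗ weightOp K = (wt S : K) • coeff S := by
    refine hom_ext fun T => ?_
    simp only [LinearMap.comp_apply, LinearMap.smul_apply, weightOp_wedge, map_smul, coeff_wedge]
    split_ifs with h <;> simp [h]
  exact congrArg (· v) this

theorem weightOp_mul_shiftedCreate (q : ℕ) :
    weightOp K * shiftedCreate K q =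
      shiftedCreate K q * weightOp K + (q : K) • shiftedCreate K q := by
  cases q with
  | zero => simp [shiftedCreate]
  | succ p =>
    refine hom_ext fun S => ?_
    simp only [shiftedCreate, Module.End.mul_apply, LinearMap.add_apply, LinearMap.smul_apply,
      weightOp_wedge, map_smul, create_wedge]
    split_ifs with h
    · simp
    · simp only [map_smul, weightOp_wedge, wt, Finset.sum_insert h]
      push_cast
      module

/-- The operator `∑_{k ≥ 1} t_k J_k` on finite wedges. -/
def ham (t : ℕ → K) : Module.End K (FinWedge K) :=
  lift fun S =>
    ∑ p ∈ S, ∑ k ∈ Finset.Icc 1 p, t k • create K (p - k) (annihilate K p (wedge K S))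

theorem ham_wedge (t : ℕ → K) (S : Finset ℕ) : ham t (wedge K S) =
    ∑ p ∈ S, ∑ k ∈ Finset.Icc 1 p, t k • create K (p - k) (annihilate K p (wedge K S)) :=
  lift_wedge _ _

/-- The part of `ham t` which moves the particles below `n`. -/
def truncHam (t : ℕ → K) (n : ℕ) : Module.End K (FinWedge K) :=
  ∑ p ∈ Finset.range n, ∑ k ∈ Finset.Icc 1 p, t k • (create K (p - k) * annihilate K p)

/-- `ham t` is only locally a finite sum. Below a cutoff it becomes an honest finite combination of
products of operators, to which the anticommutation relations apply. -/
theorem ham_wedge_eq_truncHam (t : ℕ → K) {n : ℕ} {S : Finset ℕ} (hS : S ⊆ Finset.range n) :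
    ham t (wedge K S) = truncHam t n (wedge K S) := by
  rw [ham_wedge, truncHam]
  simp only [LinearMap.sum_apply, LinearMap.smul_apply, Module.End.mul_apply]
  refine Finset.sum_subset hS fun p _ hp => ?_
  simp [annihilate_wedge, hp]

theorem create_annihilate_mul_create (i p q : ℕ) :
    create K i * annihilate K p * create K q =
      create K q * (create K i * annihilate K p) + if p = q then create K i else 0 := by
  rw [mul_assoc, annihilate_mul_create, mul_sub, ← mul_assoc, ← mul_assoc, create_mul_create i q]
  split_ifs <;> simp [add_comm]

theorem truncHam_mul_create (t : ℕ → K) {n q : ℕ} (hq : q < n) :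
    truncHam t n * create K q = create K q * truncHam t n +
      ∑ k ∈ Finset.Icc 1 q, t k • create K (q - k) := by
  simp only [truncHam, Finset.sum_mul, Finset.mul_sum, smul_mul_assoc, mul_smul_comm,
    create_annihilate_mul_create, smul_add, Finset.sum_add_distrib]
  congr 1
  rw [Finset.sum_eq_single q]
  · simp
  · intro b _ hb; simp [hb]
  · simp [hq]

/-- Quadratic terms act as derivations of the wedge product. Only the terms that annihilate at q
contribute to the commutator. -/
theorem ham_mul_create (t : ℕ → K) (q : ℕ) :
    ham t * create K q = create K q * ham t + ∑ k ∈ Finset.Icc 1 q, t k • create K (q - k) := by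
  refine hom_ext fun S => ?_
  obtain ⟨n, hn⟩ := (insert q S).exists_nat_subset_range
  have hS : S ⊆ Finset.range n := (Finset.subset_insert _ _).trans hn
  have hq : q < n := by simpa using hn (Finset.mem_insert_self q S)
  have := congrArg (· (wedge K S)) (truncHam_mul_create t hq)
  simp only [LinearMap.add_apply, Module.End.mul_apply] at this ⊢
  rw [ham_wedge_eq_truncHam t hS, ← this, create_wedge]
  split_ifs with h
  · simp
  · rw [map_smul, map_smul, ham_wedge_eq_truncHam t hn]

/-- The extra summand k = q is harmless, since it would create v_{-1} = 0. -/
theorem ham_mul_shiftedCreate (t : ℕ → K) (q : ℕ) :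
    ham t * shiftedCreate K q =
      shiftedCreate K q * ham t + ∑ k ∈ Finset.Icc 1 q, t k • shiftedCreate K (q - k) := by
  cases q with
  | zero => simp [shiftedCreate]
  | succ q =>
    rw [Finset.sum_Icc_succ_top (by omega), Nat.sub_self]
    change ham t * create K q = create K q * ham t + (_ + t (q + 1) • 0)
    rw [ham_mul_create]
    simp only [smul_zero, add_zero]
    congr 1
    refine Finset.sum_congr rfl fun k hk => ?_
    rw [Finset.mem_Icc] at hk
    rw [Nat.sub_add_comm hk.2, shiftedCreate]

theorem ham_wedge_empty (t : ℕ → K) : ham t (wedge K ∅) = 0 := by simp [ham_wedge]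

theorem ham_add (t u : ℕ → K) : ham (t + u) = ham t + ham u := by
  refine hom_ext fun S => ?_
  simp only [LinearMap.add_apply, ham_wedge, Pi.add_apply, add_smul, Finset.sum_add_distrib]

theorem ham_zero : ham (0 : ℕ → K) = 0 := by
  refine hom_ext fun S => ?_
  simp [ham_wedge]

/-- A wedge with largest element `p` is obtained from a smaller one by creating `p`. -/
theorem create_wedge_of_subset_range {p : ℕ} {S : Finset ℕ} (hS : S ⊆ Finset.range p) :
    create K p (wedge K S) = wedge K (insert p S) := by
  have hp : p ∉ S := fun h => by simpa using hS h
  have : S.filter (p < ·) = ∅ := by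
    refine Finset.filter_eq_empty_iff.2 fun q hq => ?_
    have := hS hq
    simp at this; omega
  simp [create_wedge, hp, wedgeSign, this]

/-- Induction on the largest element. -/
theorem induction_insert_max {P : Finset ℕ → Prop} (empty : P ∅)
    (insert_max : ∀ p S, S ⊆ Finset.range p → (∀ T, wt T < wt (insert p S) → P T) →
      P (insert p S)) (S : Finset ℕ) : P S := by
  induction h : wt S using Nat.strong_induction_on generalizing S with
  | _ n ih =>
    subst h
    rcases S.eq_empty_or_nonempty with rfl | hS
    · exact empty
    · have hmax := S.max'_mem hS
      rw [← Finset.insert_erase hmax]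
      refine insert_max _ _ ?_ ?_
      · intro q hq
        rw [Finset.mem_range]
        exact Finset.lt_max'_of_mem_erase_max' S hS hq
      · intro T hT
        rw [Finset.insert_erase hmax] at hT
        exact ih _ hT T rfl

theorem wt_insert {p : ℕ} {S : Finset ℕ} (hS : p ∉ S) : wt (insert p S) = p + 1 + wt S := by
  rw [wt, Finset.sum_insert hS, wt]

/-- The wedges of weight less than `n`. -/
def lowWeight (K : Type*) [Field K] (n : ℕ) : Submodule K (FinWedge K) :=
  Submodule.span K (wedge K '' {S | wt S < n})

theorem wedge_mem_lowWeight {S : Finset ℕ} {n : ℕ} (h : wt S < n) : wedge K S ∈ lowWeight K n :=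
  Submodule.subset_span ⟨S, h, rfl⟩

theorem lowWeight_mono {m n : ℕ} (h : m ≤ n) : lowWeight K m ≤ lowWeight K n :=
  Submodule.span_mono (Set.image_mono fun _ hS => lt_of_lt_of_le hS h)

theorem lowWeight_le_comap {n m : ℕ} {X : Module.End K (FinWedge K)}
    (h : ∀ S, wt S < n → X (wedge K S) ∈ lowWeight K m) {v : FinWedge K}
    (hv : v ∈ lowWeight K n) : X v ∈ lowWeight K m := by
  have : lowWeight K n ≤ (lowWeight K m).comap X := by
    rw [lowWeight, Submodule.span_le]
    rintro _ ⟨S, hS, rfl⟩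
    exact h S hS
  exact this hv

theorem shiftedCreate_wedge_mem (q : ℕ) {S : Finset ℕ} {n : ℕ} (h : wt S + q < n) :
    shiftedCreate K q (wedge K S) ∈ lowWeight K n := by
  cases q with
  | zero => simp [shiftedCreate]
  | succ p =>
    rw [shiftedCreate, create_wedge]
    split_ifs with hp
    · simp
    · refine Submodule.smul_mem _ _ (wedge_mem_lowWeight ?_)
      rw [wt_insert hp]; omega

theorem shiftedCreate_mem (q : ℕ) {n : ℕ} {v : FinWedge K} (hv : v ∈ lowWeight K n) :
    shiftedCreate K q v ∈ lowWeight K (n + q) :=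
  lowWeight_le_comap (fun S hS => shiftedCreate_wedge_mem q (by omega)) hv

/-- A jump by k ≥ 1 lowers the weight by k. This makes `ham t` locally nilpotent, so its exponential
is a finite sum on each vector. -/
theorem ham_wedge_mem (t : ℕ → K) (S : Finset ℕ) : ham t (wedge K S) ∈ lowWeight K (wt S) := by
  rw [ham_wedge]
  refine Submodule.sum_mem _ fun p hp => Submodule.sum_mem _ fun k hk => Submodule.smul_mem _ _ ?_
  rw [Finset.mem_Icc] at hk
  rw [annihilate_wedge, if_pos hp, map_smul]
  refine Submodule.smul_mem _ _ ?_
  have := wt_insert (Finset.notMem_erase p S)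
  rw [Finset.insert_erase hp] at this
  exact shiftedCreate_wedge_mem (p - k + 1) (by omega)

theorem ham_mem (t : ℕ → K) {n : ℕ} {v : FinWedge K} (hv : v ∈ lowWeight K (n + 1)) :
    ham t v ∈ lowWeight K n :=
  lowWeight_le_comap (fun S hS => lowWeight_mono (by omega) (ham_wedge_mem t S)) hv

theorem lowWeight_zero {v : FinWedge K} (hv : v ∈ lowWeight K 0) : v = 0 := by
  simpa [lowWeight] using hv

theorem ham_pow_mem (t : ℕ → K) (m : ℕ) {n : ℕ} {v : FinWedge K} (hv : v ∈ lowWeight K (n + m)) :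
    (ham t ^ m) v ∈ lowWeight K n := by
  induction m generalizing n with
  | zero => simpa using hv
  | succ m ih =>
    rw [pow_succ', Module.End.mul_apply]
    exact ham_mem t (ih (by rwa [add_right_comm, add_assoc]))

theorem coeff_eq_zero_of_mem_lowWeight {S : Finset ℕ} {v : FinWedge K} {n : ℕ}
    (hv : v ∈ lowWeight K n) (h : n ≤ wt S) : coeff S v = 0 := by
  have : lowWeight K n ≤ LinearMap.ker (coeff S) := by
    rw [lowWeight, Submodule.span_le]
    rintro _ ⟨T, hT, rfl⟩
    rw [SetLike.mem_coe, LinearMap.mem_ker, coeff_wedge, if_neg]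
    rintro rfl
    exact absurd hT (not_lt.2 h)
  exact this hv

theorem mem_lowWeight {v : FinWedge K} {n : ℕ} (h : ∀ S, n ≤ wt S → coeff S v = 0) :
    v ∈ lowWeight K n := by
  have := (Finsupp.mem_supported' K (s := {S | wt S < n}) v).2 fun S hS => h S (not_lt.1 hS)
  rwa [Finsupp.supported_eq_span_single] at this

end FinWedge

/-! ### Operators that intertwine two families of wedge products. -/

section Intertwiner

variable {K : Type*} [Field K]

/-- The wedge product with `v_p + a v_{p-1}`. -/
def createPair (a : K) (p : ℕ) : Module.End K (FinWedge K) :=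
  shiftedCreate K (p + 1) + a • shiftedCreate K p

theorem createPair_mul (a b : K) (p q : ℕ) :
    createPair a p * createPair b q = -(createPair b q * createPair a p) := by
  simp only [createPair, mul_add, add_mul, mul_smul_comm, smul_mul_assoc, neg_add,
    smul_add]
  rw [shiftedCreate_mul (p + 1) (q + 1), shiftedCreate_mul (p + 1) q, shiftedCreate_mul p (q + 1),
    shiftedCreate_mul p q, smul_smul, smul_smul, mul_comm a b]
  module

theorem createPair_mul_self [CharZero K] (a : K) (p : ℕ) : createPair a p * createPair a p = 0 := by
  have h : (2 : K) • (createPair a p * createPair a p) = 0 := by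
    rw [two_smul]
    nth_rw 1 [createPair_mul]
    exact neg_add_cancel _
  exact (smul_eq_zero.1 h).resolve_left two_ne_zero

/-- The coefficients do not involve a. An intertwiner between two values of a can therefore commute
with `ham t`. -/
theorem ham_mul_createPair (t : ℕ → K) (a : K) (p : ℕ) :
    ham t * createPair a p =
      createPair a p * ham t + ∑ k ∈ Finset.Icc 1 p, t k • createPair a (p - k) := by
  have h : ∑ k ∈ Finset.Icc 1 (p + 1), t k • shiftedCreate K (p + 1 - k) =
      ∑ k ∈ Finset.Icc 1 p, t k • shiftedCreate K (p - k + 1) := by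
    rw [Finset.sum_Icc_succ_top (by omega), Nat.sub_self, shiftedCreate, smul_zero, add_zero]
    refine Finset.sum_congr rfl fun k hk => ?_
    rw [Finset.mem_Icc] at hk
    rw [Nat.sub_add_comm hk.2]
  simp only [createPair, mul_add, add_mul, mul_smul_comm, smul_mul_assoc, smul_add,
    Finset.sum_add_distrib, ham_mul_shiftedCreate, h, Finset.smul_sum]
  have : ∀ k, a • t k • shiftedCreate K (p - k) = t k • a • shiftedCreate K (p - k) :=
    fun k => smul_comm _ _ _
  simp only [this]
  abel

theorem weightOp_mul_createPair (a : K) (p : ℕ) :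
    weightOp K * createPair a p =
      createPair a p * weightOp K + (p + 1 : K) • createPair a p - a • shiftedCreate K p := by
  simp only [createPair, mul_add, add_mul, mul_smul_comm, smul_mul_assoc,
    weightOp_mul_shiftedCreate]
  push_cast
  module

/-- The sum telescopes, and it stops without a remainder because v_{-1} = 0. -/
theorem sum_createPair (a : K) (p : ℕ) :
    ∑ k ∈ Finset.Icc 1 p, (-a) ^ k • createPair a (p - k) = -a • shiftedCreate K p := by
  induction p with
  | zero => simp [shiftedCreate]
  | succ p ih =>
    rw [← Finset.sum_Ioc_add_eq_sum_Icc (by omega), ← Finset.Icc_succ_left_eq_Ioc]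
    have : ∑ k ∈ Finset.Icc (Order.succ 1) (p + 1), (-a) ^ k • createPair a (p + 1 - k) =
        (-a) • ∑ k ∈ Finset.Icc 1 p, (-a) ^ k • createPair a (p - k) := by
      rw [Finset.smul_sum]
      refine (Finset.sum_bij (fun k _ => k + 1) ?_ ?_ ?_ ?_).symm
      · intro k hk; simp at hk ⊢; omega
      · intro k _ l _ h; simpa using h
      · intro k hk
        simp at hk
        exact ⟨k - 1, by simp; omega, by omega⟩
      · intro k _
        rw [smul_smul, ← pow_succ', Nat.add_sub_add_right]
    rw [this, ih]
    simp only [createPair, Nat.add_sub_cancel]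
    module

/-- The operators which fix the vacuum and intertwine the wedge products with `v_p - x v_{p-1}` and
`v_p + y v_{p-1}`. -/
structure Intertwines (x y : K) (T : Module.End K (FinWedge K)) : Prop where
  empty : T (wedge K ∅) = wedge K ∅
  mul_createPair : ∀ p, T * createPair (-x) p = createPair y p * T

/-- This drives the inductions on the weight: the intertwining relation handles the first term, and
the second has lower weight than the left side. -/
theorem wedge_insert_max (x : K) {p : ℕ} {S : Finset ℕ} (hS : S ⊆ Finset.range p) :
    wedge K (insert p S) =
      createPair (-x) p (wedge K S) + x • shiftedCreate K p (wedge K S) := by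
  rw [← create_wedge_of_subset_range hS]
  simp [createPair, shiftedCreate]

theorem wt_insert_max {p : ℕ} {S : Finset ℕ} (hS : S ⊆ Finset.range p) :
    wt (insert p S) = p + 1 + wt S :=
  wt_insert fun h => by simpa using hS h

theorem eq_zero_on_lowWeight {X : Module.End K (FinWedge K)} {n : ℕ}
    (h : ∀ S, wt S < n → X (wedge K S) = 0) {v : FinWedge K} (hv : v ∈ lowWeight K n) :
    X v = 0 :=
  lowWeight_zero (lowWeight_le_comap (m := 0) (fun S hS => by rw [h S hS]; simp) hv)

/-- Uniqueness principle: every wedge is built from the vacuum by the products with v_p - x v_{p-1},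
up to wedges of lower weight. Operator identities below are proved by applying it to the difference
of the two sides. -/
theorem eq_zero_of_mul_createPair {x y : K} {X : Module.End K (FinWedge K)}
    (h0 : X (wedge K ∅) = 0) (h : ∀ p, X * createPair (-x) p = createPair y p * X) : X = 0 := by
  refine hom_ext fun S => ?_
  induction S using induction_insert_max with
  | empty => simpa using h0
  | insert_max p S hS ih =>
    have h1 : X (shiftedCreate K p (wedge K S)) = 0 :=
      eq_zero_on_lowWeight (n := wt (insert p S)) ih
        (shiftedCreate_wedge_mem p (by rw [wt_insert_max hS]; omega))
    rw [wedge_insert_max x hS, map_add, map_smul, h1, ← Module.End.mul_apply, h,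
      Module.End.mul_apply, ih S (by rw [wt_insert_max hS]; omega)]
    simp

theorem Intertwines.commute_ham {x y : K} {T : Module.End K (FinWedge K)}
    (hT : Intertwines x y T) (t : ℕ → K) : T * ham t = ham t * T := by
  refine sub_eq_zero.1 (eq_zero_of_mul_createPair (x := x) (y := y) ?_ fun p => ?_)
  · simp [hT.empty, ham_wedge_empty]
  · rw [sub_mul, mul_assoc T, mul_assoc (ham t), hT.mul_createPair, ham_mul_createPair, mul_add,
      ← mul_assoc T, ← mul_assoc (ham t), hT.mul_createPair, ham_mul_createPair, mul_sub, add_mul,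
      Finset.mul_sum, Finset.sum_mul]
    simp only [mul_smul_comm, smul_mul_assoc, hT.mul_createPair]
    noncomm_ring

/-- The pair v_p + a v_{p-1} is not homogeneous, so T L - L T misses the intertwining relation by x
T v_{p-1} + y v_{p-1} T. The telescoping sum writes this defect as the commutator of `ham` with a
pair. -/
theorem Intertwines.mul_weightOp {x y : K} {T : Module.End K (FinWedge K)}
    (hT : Intertwines x y T) :
    T * weightOp K = weightOp K * T + ham (fun k => x ^ k - (-y) ^ k) * T := by
  refine sub_eq_zero.1 (eq_zero_of_mul_createPair (x := x) (y := y) ?_ fun p => ?_)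
  · simp [hT.empty, ham_wedge_empty, weightOp_wedge]
  -- The powers of x telescope to the right of T, against pairs with parameter -x; the powers of -y
  -- telescope to its left.
  · have hx : ∑ k ∈ Finset.Icc 1 p, x ^ k • (createPair y (p - k) * T) =
        x • (T * shiftedCreate K p) := by
      have := congrArg (T * ·) (sum_createPair (-x) p)
      simpa only [Finset.mul_sum, mul_smul_comm, hT.mul_createPair, neg_neg] using this
    have hy : ∑ k ∈ Finset.Icc 1 p, (-y) ^ k • (createPair y (p - k) * T) =
        -y • (shiftedCreate K p * T) := by
      have := congrArg (· * T) (sum_createPair y p)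
      simpa only [Finset.sum_mul, smul_mul_assoc] using this
    rw [sub_mul, add_mul, mul_assoc T, mul_assoc (weightOp K), mul_assoc (ham _),
      hT.mul_createPair, weightOp_mul_createPair, ← mul_assoc (ham _), ← mul_assoc (weightOp K),
      weightOp_mul_createPair, ham_mul_createPair, mul_sub, mul_add, ← mul_assoc T,
      hT.mul_createPair, mul_smul_comm, mul_smul_comm, hT.mul_createPair]
    simp only [add_mul, sub_mul, mul_sub, mul_add, Finset.sum_mul, smul_mul_assoc, sub_smul,
      Finset.sum_sub_distrib, hx, hy, mul_assoc]
    module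

/-- Unitriangularity, which singles T out among the solutions of the commutation equation with the
weight. The terms v_{p-1} in the pairs only contribute lower weight. -/
theorem Intertwines.wedge_sub_mem {x y : K} {T : Module.End K (FinWedge K)}
    (hT : Intertwines x y T) (S : Finset ℕ) :
    T (wedge K S) - wedge K S ∈ lowWeight K (wt S) := by
  induction S using induction_insert_max with
  | empty => simp [hT.empty]
  | insert_max p S hS ih =>
    have hw := wt_insert_max hS
    have hlow : ∀ U, wt U < wt (insert p S) → T (wedge K U) ∈ lowWeight K (wt U + 1) := by
      intro U hU
      have := add_mem (lowWeight_mono (by omega) (ih U hU))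
        (wedge_mem_lowWeight (K := K) (Nat.lt_succ_self (wt U)))
      simpa using this
    have h1 : T (shiftedCreate K p (wedge K S)) ∈ lowWeight K (wt (insert p S)) :=
      lowWeight_le_comap (n := wt (insert p S))
        (fun U hU => lowWeight_mono (by omega) (hlow U hU))
        (shiftedCreate_wedge_mem p (by omega))
    have h2 := shiftedCreate_mem p (hlow S (by omega))
    have h3 := shiftedCreate_mem (p + 1) (ih S (by omega))
    have h4 := congrArg (· (wedge K S)) (hT.mul_createPair p)
    simp only [Module.End.mul_apply] at h4
    rw [wedge_insert_max x hS, map_add, h4, map_smul]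
    have e : createPair y p (T (wedge K S)) + x • T (shiftedCreate K p (wedge K S)) -
        (createPair (-x) p (wedge K S) + x • shiftedCreate K p (wedge K S)) =
        shiftedCreate K (p + 1) (T (wedge K S) - wedge K S) +
          y • shiftedCreate K p (T (wedge K S)) + x • T (shiftedCreate K p (wedge K S)) := by
      simp only [createPair, LinearMap.add_apply, LinearMap.smul_apply, map_sub]
      module
    rw [e]
    refine add_mem (add_mem (lowWeight_mono ?_ h3) (Submodule.smul_mem _ _ (lowWeight_mono ?_ h2)))
      (Submodule.smul_mem _ _ h1)
    · omega
    · omega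

/-- The intertwining relation follows from its special case for the largest positions. -/
theorem Intertwines.of_max [CharZero K] {x y : K} {T : Module.End K (FinWedge K)}
    (h0 : T (wedge K ∅) = wedge K ∅)
    (h : ∀ p S, S ⊆ Finset.range p →
      T (createPair (-x) p (wedge K S)) = createPair y p (T (wedge K S))) :
    Intertwines x y T := by
  refine ⟨h0, fun p => hom_ext fun S => ?_⟩
  simp only [Module.End.mul_apply]
  induction S using induction_insert_max generalizing p with
  | empty => exact h p ∅ (by simp)
  | insert_max q S hS ih =>
    have hw := wt_insert_max hS
    rcases lt_or_ge q p with hqp | hpq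
    · refine h p _ (Finset.insert_subset (by simpa using hqp) (hS.trans ?_))
      exact Finset.range_subset_range.2 hqp.le
    -- The wedge of v_{q-1} with S has lower weight than `insert q S`, so the induction hypothesis
    -- covers it.
    have h1 : T (createPair (-x) p (shiftedCreate K q (wedge K S))) =
        createPair y p (T (shiftedCreate K q (wedge K S))) := by
      have := eq_zero_on_lowWeight (X := T * createPair (-x) p - createPair y p * T)
        (n := wt (insert q S)) (fun U hU => by
          simp only [LinearMap.sub_apply, Module.End.mul_apply, ih U hU p, sub_self])
        (shiftedCreate_wedge_mem (K := K) (S := S) q (by omega))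
      simpa [sub_eq_zero] using this
    have h2 : T (createPair (-x) p (createPair (-x) q (wedge K S))) =
        createPair y p (T (createPair (-x) q (wedge K S))) := by
      -- It remains to move the pair at p past the one at q. For p = q both sides vanish; for p < q
      -- the pairs anticommute, and after the exchange q lies above all the particles involved.
      rw [h q S hS, ← Module.End.mul_apply (createPair (-x) p),
        ← Module.End.mul_apply (createPair y p)]
      rcases hpq.eq_or_lt with rfl | hpq
      · simp [createPair_mul_self]
      · rw [createPair_mul (-x), createPair_mul y]
        simp only [LinearMap.neg_apply, Module.End.mul_apply, map_neg]
        rw [← ih S (by omega)]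
        congr 1
        have hs : ∀ r, r < q → T (createPair (-x) q (create K r (wedge K S))) =
            createPair y q (T (create K r (wedge K S))) := by
          intro r hr
          rw [create_wedge]
          split_ifs
          · simp
          · simp only [map_smul]
            rw [h q _ (Finset.insert_subset (by simpa using hr) hS)]
        have hs' : ∀ r, r ≤ q → T (createPair (-x) q (shiftedCreate K r (wedge K S))) =
            createPair y q (T (shiftedCreate K r (wedge K S))) := by
          intro r hr
          cases r with
          | zero => simp [shiftedCreate]
          | succ r => exact hs r hr
        have hc : createPair (-x) p (wedge K S) =
            shiftedCreate K (p + 1) (wedge K S) + (-x) • shiftedCreate K p (wedge K S) := rfl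
        rw [hc]
        simp only [map_add, map_smul]
        rw [hs' (p + 1) hpq, hs' p hpq.le]
    rw [wedge_insert_max x hS]
    simp only [map_add, map_smul]
    rw [h1, h2]

end Intertwiner

/-! ### The exponential, characterised by its commutator with the weight. -/

section Exponential

variable {K : Type*} [Field K]

/-- With x = y = 0 the uniqueness principle concerns operators that kill the vacuum and commute with
all creations. The commutator is one of them, because two successive shifts by k and l can be made
in either order. -/
theorem commute_ham_ham (t u : ℕ → K) : ham t * ham u = ham u * ham t := by
  refine sub_eq_zero.1 (eq_zero_of_mul_createPair (x := 0) (y := 0) ?_ fun p => ?_)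
  · simp [ham_wedge_empty]
  · have key : ∀ t u : ℕ → K, ham t * (ham u * createPair 0 p) =
        createPair 0 p * (ham t * ham u) +
        (∑ k ∈ Finset.Icc 1 p, t k • createPair 0 (p - k) * ham u +
        ∑ k ∈ Finset.Icc 1 p, u k • createPair 0 (p - k) * ham t) +
        ∑ k ∈ Finset.Icc 1 p, ∑ l ∈ Finset.Icc 1 (p - k), (u k * t l) •
          createPair 0 (p - k - l) := by
      intro t u
      rw [ham_mul_createPair, mul_add, ← mul_assoc, ham_mul_createPair, Finset.mul_sum, add_mul,
        Finset.sum_mul]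
      simp only [mul_smul_comm, ham_mul_createPair, smul_add, Finset.sum_add_distrib,
        Finset.smul_sum, smul_smul, smul_mul_assoc]
      noncomm_ring
    rw [neg_zero, sub_mul, mul_assoc, mul_assoc, key, key]
    have : ∑ k ∈ Finset.Icc 1 p, ∑ l ∈ Finset.Icc 1 (p - k), (t k * u l) •
          createPair (0 : K) (p - k - l) =
        ∑ k ∈ Finset.Icc 1 p, ∑ l ∈ Finset.Icc 1 (p - k), (u k * t l) •
          createPair (0 : K) (p - k - l) := by
      rw [Finset.sum_comm' (t' := Finset.Icc 1 p) (s' := fun l => Finset.Icc 1 (p - l))]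
      · refine Finset.sum_congr rfl fun k _ => Finset.sum_congr rfl fun l _ => ?_
        rw [mul_comm, Nat.sub_right_comm]
      · intro k l; simp only [Finset.mem_Icc]; omega
    rw [this, mul_sub]
    abel

/-- The commutator of the weight with `ham t`. -/
theorem ham_mul_weightOp (t : ℕ → K) :
    ham t * weightOp K = weightOp K * ham t + ham (fun k => k * t k) := by
  refine sub_eq_zero.1 (eq_zero_of_mul_createPair (x := 0) (y := 0) ?_ fun p => ?_)
  · simp [ham_wedge_empty, weightOp_wedge]
  · have hs : ∀ k ∈ Finset.Icc 1 p, t k • (weightOp K * createPair 0 (p - k)) =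
        t k • (createPair 0 (p - k) * weightOp K) + ((p + 1 : K) * t k) • createPair 0 (p - k) -
          (k * t k) • createPair 0 (p - k) := by
      intro k hk
      rw [Finset.mem_Icc] at hk
      rw [weightOp_mul_createPair, Nat.cast_sub hk.2]
      module
    rw [neg_zero, sub_mul, add_mul, mul_assoc, mul_assoc, weightOp_mul_createPair,
      ham_mul_createPair, ham_mul_createPair]
    simp only [mul_add, mul_sub, Finset.mul_sum, mul_smul_comm, zero_smul, sub_zero]
    rw [Finset.sum_congr rfl hs, ← mul_assoc, ← mul_assoc, ham_mul_createPair,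
      weightOp_mul_createPair]
    simp only [add_mul, Finset.sum_mul, Finset.sum_add_distrib, Finset.sum_sub_distrib,
      smul_add, Finset.smul_sum, smul_mul_assoc, smul_smul, zero_smul, sub_zero]
    noncomm_ring

/-- Leibniz rule for the commutator with the weight; the m + 1 terms coincide because [H, L]
commutes with H. -/
theorem ham_pow_mul_weightOp (t : ℕ → K) (m : ℕ) :
    ham t ^ (m + 1) * weightOp K =
      weightOp K * ham t ^ (m + 1) + (m + 1 : K) • (ham (fun k => k * t k) * ham t ^ m) := by
  induction m with
  | zero => simp [ham_mul_weightOp]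
  | succ m ih =>
    rw [pow_succ', mul_assoc, ih, mul_add, ← mul_assoc, ham_mul_weightOp, mul_smul_comm,
      ← mul_assoc, commute_ham_ham t, mul_assoc _ (ham t), ← pow_succ', add_mul, mul_assoc,
      ← pow_succ']
    push_cast
    module

/-- The vector `e^H |β⟩` for `H = ham t`. -/
def expVec (t : ℕ → K) (β : Finset ℕ) : FinWedge K :=
  ∑ m ∈ Finset.range (wt β + 1), ((m.factorial : K))⁻¹ • (ham t ^ m) (wedge K β)

theorem ham_pow_wedge_eq_zero (t : ℕ → K) {β : Finset ℕ} {m : ℕ} (h : wt β < m) :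
    (ham t ^ m) (wedge K β) = 0 :=
  lowWeight_zero (ham_pow_mem t m (wedge_mem_lowWeight (by simpa using h)))

theorem expVec_sub_mem (t : ℕ → K) (β : Finset ℕ) :
    expVec t β - wedge K β ∈ lowWeight K (wt β) := by
  rw [expVec, Finset.sum_range_succ']
  simp only [Nat.factorial_zero, Nat.cast_one, inv_one, pow_zero, one_smul, Module.End.one_apply,
    add_sub_cancel_right]
  refine Submodule.sum_mem _ fun m _ => Submodule.smul_mem _ _ ?_
  exact ham_pow_mem t (m + 1) (wedge_mem_lowWeight (by omega))

/-- This is e^H L = (L + [H, L]) e^H applied to β: the factor m + 1 from the Leibniz rule turns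
1/(m+1)! into 1/m!. -/
theorem weightOp_expVec [CharZero K] (t : ℕ → K) (β : Finset ℕ) :
    (wt β : K) • expVec t β =
      weightOp K (expVec t β) + ham (fun k => k * t k) (expVec t β) := by
  have h : ∀ m : ℕ, (wt β : K) • (ham t ^ (m + 1)) (wedge K β) =
      weightOp K ((ham t ^ (m + 1)) (wedge K β)) +
        (m + 1 : K) • ham (fun k => k * t k) ((ham t ^ m) (wedge K β)) := by
    intro m
    have := congrArg (· (wedge K β)) (ham_pow_mul_weightOp t m)
    simpa [weightOp_wedge] using this
  -- The truncated sum loses nothing: wt β + 1 lowerings of a wedge of weight wt β give zero.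
  have h2 : ham (fun k => k * t k) ((ham t ^ wt β) (wedge K β)) = 0 :=
    lowWeight_zero (ham_mem _ (ham_pow_mem t _ (wedge_mem_lowWeight (by omega))))
  have h3 : ham (fun k => k * t k) (expVec t β) = ∑ m ∈ Finset.range (wt β),
      ((m.factorial : K))⁻¹ • ham (fun k => k * t k) ((ham t ^ m) (wedge K β)) := by
    rw [expVec, map_sum, Finset.sum_range_succ, map_smul, h2, smul_zero, add_zero]
    simp only [map_smul]
  rw [h3, expVec, Finset.sum_range_succ']
  simp only [map_add, map_sum, map_smul, smul_add, Finset.smul_sum]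
  rw [add_right_comm, ← Finset.sum_add_distrib]
  congr 1
  · refine Finset.sum_congr rfl fun m _ => ?_
    rw [smul_comm, h, smul_add, smul_smul]
    congr 2
    rw [Nat.factorial_succ]
    have : (m + 1 : K) ≠ 0 := by exact_mod_cast Nat.succ_ne_zero m
    push_cast
    field_simp
  · simp [weightOp_wedge]

/-- A solution of the equation `wt β - L = H'` without terms of weight at least `wt β` is zero. -/
theorem eq_zero_of_weightOp [CharZero K] {u : ℕ → K} {n : ℕ} {v : FinWedge K}
    (hv : v ∈ lowWeight K n) (h : (n : K) • v = weightOp K v + ham u v) : v = 0 := by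
  suffices ∀ m ≤ n, v ∈ lowWeight K m from lowWeight_zero (this 0 n.zero_le)
  intro m hm
  induction hm using Nat.decreasingInduction with
  | self => exact hv
  | of_succ m hm ih =>
    refine mem_lowWeight fun S hS => ?_
    rcases hS.eq_or_lt with hS | hS
    · have h1 := congrArg (coeff S) h
      rw [map_add, map_smul, coeff_weightOp, coeff_eq_zero_of_mem_lowWeight (ham_mem u ih) hS.le,
        add_zero, ← hS, smul_eq_mul] at h1
      by_contra hne
      have := mul_right_cancel₀ hne h1
      rw [Nat.cast_inj] at this
      omega
    · exact coeff_eq_zero_of_mem_lowWeight ih hS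

/-- The products of intertwiners are exponentials. -/
theorem eq_expVec [CharZero K] {t : ℕ → K} {G : Module.End K (FinWedge K)}
    (hG : G * weightOp K = weightOp K * G + ham (fun k => k * t k) * G)
    (hlow : ∀ S, G (wedge K S) - wedge K S ∈ lowWeight K (wt S)) (β : Finset ℕ) :
    G (wedge K β) = expVec t β := by
  refine sub_eq_zero.1 (eq_zero_of_weightOp (n := wt β) (u := fun k => k * t k) ?_ ?_)
  · have := sub_mem (hlow β) (expVec_sub_mem t β)
    simpa using this
  · have h1 := congrArg (· (wedge K β)) hG
    simp only [Module.End.mul_apply, LinearMap.add_apply, weightOp_wedge, map_smul] at h1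
    rw [smul_sub, weightOp_expVec, h1, map_sub, map_sub]
    abel

/-- Composition of row operators, the first one acting first. -/
def prodOp (T : ℕ → Module.End K (FinWedge K)) : ℕ → Module.End K (FinWedge K)
  | 0 => 1
  | N + 1 => T N * prodOp T N

theorem prodOp_wedge [CharZero K] {x y : ℕ → K} {T : ℕ → Module.End K (FinWedge K)}
    (hT : ∀ i, Intertwines (x i) (y i) (T i)) {t : ℕ → K} (N : ℕ)
    (ht : ∀ k : ℕ, 1 ≤ k → k * t k = ∑ i ∈ Finset.range N, (x i ^ k - (-y i) ^ k))
    (β : Finset ℕ) : prodOp T N (wedge K β) = expVec t β := by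
  have hham : ham (fun k => k * t k) =
      ham (fun k => ∑ i ∈ Finset.range N, (x i ^ k - (-y i) ^ k)) := by
    refine hom_ext fun S => ?_
    rw [ham_wedge, ham_wedge]
    refine Finset.sum_congr rfl fun p _ => Finset.sum_congr rfl fun k hk => ?_
    rw [ht k (Finset.mem_Icc.1 hk).1]
  refine eq_expVec ?_ (fun S => ?_) β
  · rw [hham]
    clear hham ht
    induction N with
    | zero =>
      simp only [prodOp, Finset.range_zero, Finset.sum_empty]
      have : ham (fun _ => (0 : K)) = 0 := ham_zero
      simp [this]
    | succ N ih =>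
      simp only [prodOp, Finset.sum_range_succ]
      have : ham (fun k => ∑ i ∈ Finset.range N, (x i ^ k - (-y i) ^ k) + (x N ^ k - (-y N) ^ k)) =
          ham (fun k => ∑ i ∈ Finset.range N, (x i ^ k - (-y i) ^ k)) +
            ham (fun k => x N ^ k - (-y N) ^ k) := ham_add _ _
      -- Leibniz rule for the product of rows: the new row operator commutes with the `ham` of the
      -- earlier rows, so the contributions add.
      rw [this, mul_assoc, ih, mul_add, ← mul_assoc, (hT N).mul_weightOp, ← mul_assoc (T N),
        (hT N).commute_ham]
      noncomm_ring
  · clear hham ht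
    induction N with
    | zero => simp [prodOp]
    | succ N ih =>
      have h1 : T N (prodOp T N (wedge K S) - wedge K S) ∈ lowWeight K (wt S) := by
        refine lowWeight_le_comap (n := wt S) (fun U hU => ?_) ih
        have := add_mem (lowWeight_mono hU.le ((hT N).wedge_sub_mem U))
          (wedge_mem_lowWeight (K := K) hU)
        simpa using this
      have := add_mem h1 ((hT N).wedge_sub_mem S)
      simpa [prodOp] using this

end Exponential

/-! ### Partition functions as products of transfer matrices -/

section Path

variable {K : Type*} [Field K]

/-- The entry `(a, b)` of the product of the matrices `P 0, …, P (N - 1)`. -/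
def pathSum {α : Type*} [Fintype α] [DecidableEq α] (P : ℕ → α → α → K) : ℕ → α → α → K
  | 0, a, b => if a = b then 1 else 0
  | N + 1, a, b => ∑ c, pathSum P N a c * P N c b

/-- Used twice: for the stack of rows, with the vertical spins of a row as states, and for the
columns within a row, with a horizontal spin as state. -/
theorem sum_paths {α : Type*} [Fintype α] [DecidableEq α] (P : ℕ → α → α → K) (N : ℕ) (a b : α) :
    ∑ v : Fin (N + 1) → α, (if v 0 = a ∧ v (Fin.last N) = b then
      ∏ i : Fin N, P i (v i.castSucc) (v i.succ) else 0) = pathSum P N a b := by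
  induction N generalizing b with
  | zero =>
    rw [← (Equiv.funUnique (Fin 1) α).symm.sum_comp]
    simp only [pathSum, Finset.univ_eq_empty, Finset.prod_empty]
    by_cases h : a = b
    · subst h
      rw [Finset.sum_eq_single a] <;> simp +contextual [Equiv.funUnique]
    · rw [if_neg h]
      refine Finset.sum_eq_zero fun c _ => if_neg ?_
      rintro ⟨h1, h2⟩
      exact h (h1.symm.trans h2)
  | succ N ih =>
    rw [← (Fin.snocEquiv fun _ : Fin (N + 2) => α).sum_comp, Fintype.sum_prod_type]
    have h0 : ∀ (c : α) (v : Fin (N + 1) → α),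
        (Fin.snoc v c : Fin (N + 2) → α) 0 = v 0 := fun c v =>
      Fin.snoc_castSucc (α := fun _ => α) c v 0
    have hs : ∀ (c : α) (v : Fin (N + 1) → α) (i : Fin N),
        (Fin.snoc v c : Fin (N + 2) → α) i.castSucc.succ = v i.succ := fun c v i =>
      Fin.snoc_castSucc (α := fun _ => α) c v i.succ
    simp only [Fin.snocEquiv, Equiv.coe_fn_mk, h0, Fin.snoc_last, Fin.prod_univ_castSucc,
      Fin.snoc_castSucc, hs, Fin.succ_last, Fin.val_castSucc, Fin.val_last]
    rw [Finset.sum_eq_single b (fun c _ hc => by simp [hc]) (by simp), pathSum]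
    simp only [← ih, Finset.sum_mul]
    rw [Finset.sum_comm]
    refine Finset.sum_congr rfl fun v _ => ?_
    rw [Finset.sum_eq_single (v (Fin.last N)) (fun c _ hc => by simp [Ne.symm hc]) (by simp)]
    simp [ite_mul]

theorem pathSum_congr {α : Type*} [Fintype α] [DecidableEq α] {P Q : ℕ → α → α → K} {N : ℕ}
    (h : ∀ i < N, P i = Q i) (a b : α) : pathSum P N a b = pathSum Q N a b := by
  induction N generalizing b with
  | zero => rfl
  | succ N ih =>
    simp only [pathSum, h N (Nat.lt_succ_self N), ih fun i hi => h i (Nat.lt_succ_of_lt hi)]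

/-- The spin on column `c` of a row of vertical edges with `-` exactly on `S`. -/
def spin (S : Finset ℕ) (c : ℕ) : Spin := if c ∈ S then Spin.minus else Spin.plus

/-- The first `n` columns of a row with bottom spins `lam` and top spins `mu`, with left boundary
spin `+` and spin `s` to the right of these columns. -/
def rowSum (w : Weights K) (lam mu : Finset ℕ) (n : ℕ) (s : Spin) : K :=
  pathSum (fun c l r => w.vertex l (spin mu c) r (spin lam c)) n Spin.plus s

variable (w : Weights K) (lam mu : Finset ℕ) (n : ℕ)

theorem rowSum_zero (s : Spin) : rowSum w lam mu 0 s = if s = Spin.plus then 1 else 0 := by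
  simp [rowSum, pathSum, eq_comm]

theorem sum_spin (f : Spin → K) : ∑ s, f s = f Spin.plus + f Spin.minus := by
  change ∑ s ∈ ({Spin.plus, Spin.minus} : Finset Spin), f s = _
  rw [Finset.sum_pair (by decide)]

theorem rowSum_succ_plus : rowSum w lam mu (n + 1) Spin.plus =
    if n ∈ lam then
      if n ∈ mu then rowSum w lam mu n Spin.plus * w.b₁ else rowSum w lam mu n Spin.minus * w.c₁
    else if n ∈ mu then 0 else rowSum w lam mu n Spin.plus * w.a₁ := by
  simp only [rowSum, pathSum, sum_spin, spin]
  split_ifs <;> simp [Weights.vertex]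

theorem rowSum_succ_minus : rowSum w lam mu (n + 1) Spin.minus =
    if n ∈ lam then
      if n ∈ mu then rowSum w lam mu n Spin.minus * w.a₂ else 0
    else if n ∈ mu then rowSum w lam mu n Spin.plus * w.c₂
      else rowSum w lam mu n Spin.minus * w.b₂ := by
  simp only [rowSum, pathSum, sum_spin, spin]
  split_ifs <;> simp [Weights.vertex]

variable {lam mu n}

theorem rowSum_congr {lam' mu' : Finset ℕ} (h : ∀ c < n, c ∈ lam ↔ c ∈ lam')
    (h' : ∀ c < n, c ∈ mu ↔ c ∈ mu') (s : Spin) :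
    rowSum w lam mu n s = rowSum w lam' mu' n s :=
  pathSum_congr (fun c hc => by simp only [spin, h c hc, h' c hc]) _ _

/-! ### Partition functions by recursion on the rows. -/

theorem boundary_bij (M : ℕ) : Set.BijOn (boundary M)
    ((Finset.range (M + 1)).powerset : Set (Finset ℕ)) Set.univ := by
  refine ⟨fun _ _ => trivial, fun S hS T hT h => ?_, fun v _ => ?_⟩
  · ext c
    simp only [Finset.mem_coe, Finset.mem_powerset] at hS hT
    by_cases hc : c < M + 1
    · have := congrFun h ⟨c, hc⟩
      simp only [boundary] at this
      by_cases h1 : c ∈ S <;> by_cases h2 : c ∈ T <;> simp_all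
    · have h1 : c ∉ S := fun h => hc (by simpa using hS h)
      have h2 : c ∉ T := fun h => hc (by simpa using hT h)
      simp [h1, h2]
  · refine ⟨(Finset.univ.filter fun c => v c = Spin.minus).image Fin.val, ?_, ?_⟩
    · simp only [Finset.mem_coe, Finset.mem_powerset]
      intro c hc
      simp only [Finset.mem_image, Finset.mem_filter] at hc
      obtain ⟨d, _, rfl⟩ := hc
      exact Finset.mem_range.2 d.2
    · funext c
      have : (c : ℕ) ∈ (Finset.univ.filter fun c => v c = Spin.minus).image Fin.val ↔
          v c = Spin.minus := by
        simp [Fin.val_inj]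
      simp only [boundary, this]
      cases h : v c <;> simp

/-- The weight of a row of width `M + 1`, as a function of its vertical spins. -/
def rowMatrix (w : Weights K) (M : ℕ) (b t : Fin (M + 1) → Spin) : K :=
  ∑ h : Fin (M + 2) → Spin, if h 0 = Spin.plus ∧ h (Fin.last (M + 1)) = Spin.plus then
    ∏ c : Fin (M + 1), w.vertex (h c.castSucc) (t c) (h c.succ) (b c) else 0

theorem rowMatrix_boundary (M : ℕ) (lam mu : Finset ℕ) :
    rowMatrix w M (boundary M lam) (boundary M mu) = rowSum w lam mu (M + 1) Spin.plus := by
  rw [rowSum, ← sum_paths]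
  rfl

theorem Z_eq_pathSum (W : ℕ → Weights K) (N M : ℕ) (lam mu : Finset ℕ) :
    Z W N M lam mu =
      pathSum (fun i => rowMatrix (W i) M) N (boundary M lam) (boundary M mu) := by
  rw [← sum_paths, Z]
  refine Finset.sum_congr rfl fun v _ => ?_
  by_cases hv : v 0 = boundary M lam ∧ v (Fin.last N) = boundary M mu
  · rw [if_pos hv]
    simp only [hv.1, hv.2, true_and, rowMatrix]
    rw [Finset.prod_univ_sum, Fintype.piFinset_univ]
    refine Finset.sum_congr rfl fun h _ => ?_
    split_ifs with hh
    · refine Finset.prod_congr rfl fun i _ => ?_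
      rw [if_pos (hh i)]
    · push Not at hh
      obtain ⟨i, hi⟩ := hh
      exact (Finset.prod_eq_zero (Finset.mem_univ i) (if_neg fun h => hi h.1 h.2)).symm
  · rw [if_neg hv]
    refine Finset.sum_eq_zero fun h _ => if_neg fun hh => hv ⟨hh.1, hh.2.1⟩

theorem Z_zero (W : ℕ → Weights K) {M : ℕ} {lam mu : Finset ℕ}
    (hlam : lam ⊆ Finset.range (M + 1)) (hmu : mu ⊆ Finset.range (M + 1)) :
    Z W 0 M lam mu = if lam = mu then 1 else 0 := by
  rw [Z_eq_pathSum, pathSum]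
  have : boundary M lam = boundary M mu ↔ lam = mu :=
    (boundary_bij M).injOn.eq_iff (Finset.mem_coe.2 (Finset.mem_powerset.2 hlam))
      (Finset.mem_coe.2 (Finset.mem_powerset.2 hmu))
  simp only [this]

theorem Z_succ (W : ℕ → Weights K) (N M : ℕ) (lam mu : Finset ℕ) :
    Z W (N + 1) M lam mu = ∑ kap ∈ (Finset.range (M + 1)).powerset,
      Z W N M lam kap * rowSum (W N) kap mu (M + 1) Spin.plus := by
  rw [Z_eq_pathSum, pathSum]
  have hb := boundary_bij M
  refine (Finset.sum_bij (fun S _ => boundary M S) (fun _ _ => Finset.mem_univ _)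
    (fun S hS T hT h => hb.injOn hS hT h) (fun v _ => ?_) (fun S _ => ?_)).symm
  · obtain ⟨S, hS, rfl⟩ := hb.surjOn (Set.mem_univ v)
    exact ⟨S, hS, rfl⟩
  · rw [Z_eq_pathSum, rowMatrix_boundary]

/-- The row sums depend on `c₁` and `c₂` through their product only. -/
theorem rowSum_gauge {w w' : Weights K} (ha₁ : w.a₁ = w'.a₁) (ha₂ : w.a₂ = w'.a₂)
    (hb₁ : w.b₁ = w'.b₁) (hb₂ : w.b₂ = w'.b₂) (hc : w.c₁ * w.c₂ = w'.c₁ * w'.c₂)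
    (lam mu : Finset ℕ) (n : ℕ) :
    rowSum w lam mu n Spin.plus = rowSum w' lam mu n Spin.plus ∧
      rowSum w lam mu n Spin.minus * w.c₁ = rowSum w' lam mu n Spin.minus * w'.c₁ := by
  induction n with
  | zero => simp [rowSum_zero]
  | succ n ih =>
    obtain ⟨h1, h2⟩ := ih
    rw [rowSum_succ_plus, rowSum_succ_plus, rowSum_succ_minus, rowSum_succ_minus, ha₁, ha₂, hb₁,
      hb₂, h1, h2]
    -- A path that starts with spin + meets c₂ and c₁ alternately. While the spin is - one c₂ is
    -- still unpaired, hence the compensating factor c₁.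
    refine ⟨rfl, ?_⟩
    split_ifs
    · linear_combination w'.a₂ * h2
    · simp
    · linear_combination rowSum w' lam mu n Spin.plus * hc
    · linear_combination w'.b₂ * h2

theorem Z_gauge {W W' : ℕ → Weights K} (ha₁ : ∀ i, (W i).a₁ = (W' i).a₁)
    (ha₂ : ∀ i, (W i).a₂ = (W' i).a₂) (hb₁ : ∀ i, (W i).b₁ = (W' i).b₁)
    (hb₂ : ∀ i, (W i).b₂ = (W' i).b₂) (hc : ∀ i, (W i).c₁ * (W i).c₂ = (W' i).c₁ * (W' i).c₂)
    (N M : ℕ) (lam mu : Finset ℕ) : Z W N M lam mu = Z W' N M lam mu := by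
  induction N generalizing mu with
  | zero => rw [Z_eq_pathSum, Z_eq_pathSum, pathSum, pathSum]
  | succ N ih =>
    rw [Z_succ, Z_succ]
    refine Finset.sum_congr rfl fun S _ => ?_
    rw [ih, (rowSum_gauge (ha₁ N) (ha₂ N) (hb₁ N) (hb₂ N) (hc N) _ _ _).1]

theorem filter_lt_succ (S : Finset ℕ) (n : ℕ) : (S.filter (· < n + 1)).card =
    (S.filter (· < n)).card + if n ∈ S then 1 else 0 := by
  split_ifs with h
  · rw [← Finset.card_insert_of_notMem (a := n) (by simp)]
    congr 1
    ext c
    simp only [Finset.mem_filter, Finset.mem_insert]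
    constructor
    · rintro ⟨h1, h2⟩
      rcases Nat.lt_succ_iff_lt_or_eq.1 h2 with h3 | h3 <;> simp [*]
    · rintro (rfl | ⟨h1, h2⟩)
      · exact ⟨h, by omega⟩
      · exact ⟨h1, by omega⟩
  · rw [add_zero]
    congr 1
    refine Finset.filter_congr fun c hc => ?_
    have : c ≠ n := fun e => h (e ▸ hc)
    omega

/-- Particle conservation. -/
theorem rowSum_conserve (w : Weights K) (lam mu : Finset ℕ) (n : ℕ) :
    (rowSum w lam mu n Spin.plus ≠ 0 →
      (lam.filter (· < n)).card = (mu.filter (· < n)).card) ∧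
    (rowSum w lam mu n Spin.minus ≠ 0 →
      (lam.filter (· < n)).card + 1 = (mu.filter (· < n)).card) := by
  induction n with
  | zero => simp [rowSum_zero]
  | succ n ih =>
    obtain ⟨h1, h2⟩ := ih
    rw [rowSum_succ_plus, rowSum_succ_minus, filter_lt_succ, filter_lt_succ]
    constructor
    · split_ifs <;> intro h <;> first | exact absurd rfl h | skip
      · rw [h1 (left_ne_zero_of_mul h)]
      · rw [← h2 (left_ne_zero_of_mul h)]
      · rw [h1 (left_ne_zero_of_mul h)]
    · split_ifs <;> intro h <;> first | exact absurd rfl h | skip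
      · rw [h2 (left_ne_zero_of_mul h)]
      · rw [← h1 (left_ne_zero_of_mul h)]
      · rw [← h2 (left_ne_zero_of_mul h)]

theorem filter_lt_of_subset {S : Finset ℕ} {n : ℕ} (h : S ⊆ Finset.range n) :
    S.filter (· < n) = S :=
  Finset.filter_true_of_mem fun c hc => by simpa using h hc

theorem Z_conserve (W : ℕ → Weights K) {N M : ℕ} {lam mu : Finset ℕ}
    (hlam : lam ⊆ Finset.range (M + 1)) (hmu : mu ⊆ Finset.range (M + 1))
    (h : Z W N M lam mu ≠ 0) : lam.card = mu.card := by
  induction N generalizing mu with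
  | zero =>
    rw [Z_zero W hlam hmu] at h
    split_ifs at h with e
    · rw [e]
    · simp at h
  | succ N ih =>
    rw [Z_succ] at h
    obtain ⟨kap, hk, h⟩ := Finset.exists_ne_zero_of_sum_ne_zero h
    rw [Finset.mem_powerset] at hk
    rw [ih hk (left_ne_zero_of_mul h)]
    have := (rowSum_conserve (W N) kap mu (M + 1)).1 (right_ne_zero_of_mul h)
    rwa [filter_lt_of_subset hk, filter_lt_of_subset hmu] at this

/-- The normalised weights, with `A = B = 1`. -/
def unitWeights (x y : K) : Weights K where
  a₁ := 1
  a₂ := y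
  b₁ := 1
  b₂ := x
  c₁ := x + y
  c₂ := 1

/-- Every vertex weight contains A once, and it contains B exactly when its bottom spin is -. -/
theorem rowSum_weights (x y A B : ℕ → K) (i : ℕ) (lam mu : Finset ℕ) (n : ℕ) (s : Spin) :
    rowSum (weights x y A B i) lam mu n s =
      A i ^ n * B i ^ (lam.filter (· < n)).card * rowSum (unitWeights (x i) (y i)) lam mu n s := by
  induction n generalizing s with
  | zero => simp [rowSum_zero]
  | succ n ih =>
    cases s
    · rw [rowSum_succ_plus, rowSum_succ_plus, ih, ih, filter_lt_succ]
      split_ifs <;> (try simp only [weights, unitWeights]) <;> ring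
    · rw [rowSum_succ_minus, rowSum_succ_minus, ih, ih, filter_lt_succ]
      split_ifs <;> (try simp only [weights, unitWeights]) <;> ring

theorem Z_weights (x y A B : ℕ → K) (N : ℕ) {M : ℕ} {lam mu : Finset ℕ}
    (hlam : lam ⊆ Finset.range (M + 1)) (hmu : mu ⊆ Finset.range (M + 1)) :
    Z (weights x y A B) N M lam mu =
      factor A B N M lam.card * Z (fun i => unitWeights (x i) (y i)) N M lam mu := by
  induction N generalizing mu with
  | zero => simp [Z_zero _ hlam hmu, factor]
  | succ N ih =>
    rw [Z_succ, Z_succ, Finset.mul_sum]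
    refine Finset.sum_congr rfl fun kap hk => ?_
    rw [Finset.mem_powerset] at hk
    rw [ih hk, rowSum_weights, filter_lt_of_subset hk, factor, factor, Finset.prod_range_succ]
    -- Only intermediate configurations with as many particles as `lam` contribute, so the power of
    -- B is the same in all terms.
    by_cases h : Z (fun i => unitWeights (x i) (y i)) N M lam kap = 0
    · simp [h]
    · rw [Z_conserve _ hlam hk h]
      ring

/-! ### The row operator -/

/-- Columns to the right of all particles carry a₁ = 1. The row therefore defines an operator
independent of the width. -/
theorem rowSum_stable (x y : K) {lam : Finset ℕ} {m n : ℕ} (hmn : m ≤ n)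
    (hlam : lam ⊆ Finset.range m) (mu : Finset ℕ) :
    (if mu ⊆ Finset.range n then rowSum (unitWeights x y) lam mu n Spin.plus else 0) =
      if mu ⊆ Finset.range m then rowSum (unitWeights x y) lam mu m Spin.plus else 0 := by
  induction n, hmn using Nat.le_induction with
  | base => rfl
  | succ n hmn ih =>
    rw [← ih, rowSum_succ_plus]
    have hn : n ∉ lam := fun h => by have := hlam h; simp at this; omega
    by_cases hmu : n ∈ mu
    · have : ¬ mu ⊆ Finset.range n := fun h => by simpa using h hmu
      simp [hn, hmu, this]
    · have : mu ⊆ Finset.range (n + 1) ↔ mu ⊆ Finset.range n := by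
        rw [Finset.range_add_one, Finset.subset_insert_iff_of_notMem hmu]
      simp [hn, hmu, this, unitWeights]

theorem subset_range_sup (S : Finset ℕ) : S ⊆ Finset.range (S.sup (· + 1)) := fun _ hc =>
  Finset.mem_range.2 (Finset.le_sup (f := (· + 1)) hc)

/-- The transfer operator of one row with weights `unitWeights x y`. -/
def rowOp (x y : K) : Module.End K (FinWedge K) :=
  lift fun lam => ∑ mu ∈ (Finset.range (lam.sup (· + 1))).powerset,
    rowSum (unitWeights x y) lam mu (lam.sup (· + 1)) Spin.plus • wedge K mu

theorem rowOp_wedge (x y : K) {lam : Finset ℕ} {n : ℕ} (hlam : lam ⊆ Finset.range n)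
    (mu : Finset ℕ) : coeff mu (rowOp x y (wedge K lam)) =
      if mu ⊆ Finset.range n then rowSum (unitWeights x y) lam mu n Spin.plus else 0 := by
  have hle : lam.sup (· + 1) ≤ n := Finset.sup_le fun c hc => by simpa using hlam hc
  rw [rowSum_stable x y hle (subset_range_sup lam), rowOp, lift_wedge, map_sum]
  simp only [map_smul, coeff_wedge, smul_eq_mul, mul_ite, mul_one, mul_zero]
  rw [Finset.sum_ite_eq']
  simp only [Finset.mem_powerset]

theorem coeff_create (p : ℕ) (mu : Finset ℕ) (v : FinWedge K) : coeff mu (create K p v) =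
    if p ∈ mu then wedgeSign K (mu.erase p) p * coeff (mu.erase p) v else 0 := by
  split_ifs with h
  · have : coeff mu ∘ₗ create K p = wedgeSign K (mu.erase p) p • coeff (mu.erase p) := by
      refine hom_ext fun S => ?_
      simp only [LinearMap.comp_apply, LinearMap.smul_apply, create_wedge, coeff_wedge]
      by_cases hS : S = mu.erase p
      · subst hS; simp [coeff_wedge, Finset.insert_erase h]
      · split_ifs with h1
        · simp
        · have : insert p S ≠ mu := by
            rintro rfl
            exact hS (Finset.erase_insert h1).symm
          simp [coeff_wedge, this]
    exact congrArg (· v) this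
  · have : coeff mu ∘ₗ create K p = 0 := by
      refine hom_ext fun S => ?_
      simp only [LinearMap.comp_apply, create_wedge]
      split_ifs with h1
      · simp
      · have : insert p S ≠ mu := by
          rintro rfl
          simp at h
        simp [coeff_wedge, this]
    exact congrArg (· v) this

theorem wedgeSign_of_subset_range {p : ℕ} {S : Finset ℕ} (hS : S ⊆ Finset.range p) :
    wedgeSign K S p = 1 := by
  have : S.filter (p < ·) = ∅ := by
    refine Finset.filter_eq_empty_iff.2 fun q hq => ?_
    have := hS hq
    simp at this; omega
  simp [wedgeSign, this]

theorem coeff_create_rowOp (x y : K) {p : ℕ} {S : Finset ℕ} (hS : S ⊆ Finset.range p)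
    (mu : Finset ℕ) : coeff mu (create K p (rowOp x y (wedge K S))) =
      if mu ⊆ Finset.range (p + 1) ∧ p ∈ mu then
        rowSum (unitWeights x y) S mu p Spin.plus else 0 := by
  rw [coeff_create, rowOp_wedge x y hS]
  simp only [Finset.range_add_one, Finset.subset_insert_iff]
  by_cases hp : p ∈ mu
  · by_cases hmu : mu.erase p ⊆ Finset.range p
    · simp only [hp, hmu, if_true, and_self, wedgeSign_of_subset_range hmu, one_mul]
      refine rowSum_congr _ (fun _ _ => Iff.rfl) (fun c hc => ?_) _
      simp [hc.ne]
    · simp [hmu]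
  · simp [hp]

theorem coeff_create_rowOp_succ (x y : K) {q : ℕ} {S : Finset ℕ}
    (hS : S ⊆ Finset.range (q + 1)) (mu : Finset ℕ) :
    coeff mu (create K q (rowOp x y (wedge K S))) =
      if mu ⊆ Finset.range (q + 1) ∧ q ∈ mu then
        if q ∈ S then rowSum (unitWeights x y) S mu q Spin.minus * (x + y)
        else rowSum (unitWeights x y) S mu q Spin.plus else 0 := by
  rw [coeff_create, rowOp_wedge x y hS]
  by_cases hq : q ∈ mu
  · by_cases hmu : mu ⊆ Finset.range (q + 1)
    · have h1 : mu.erase q ⊆ Finset.range q := by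
        rwa [Finset.range_add_one, Finset.subset_insert_iff] at hmu
      have h2 : ∀ s, rowSum (unitWeights x y) S (mu.erase q) q s =
          rowSum (unitWeights x y) S mu q s := fun s =>
        rowSum_congr _ (fun _ _ => Iff.rfl) (fun c hc => by simp [hc.ne]) s
      rw [if_pos hq, if_pos ((Finset.erase_subset _ _).trans hmu), if_pos ⟨hmu, hq⟩,
        wedgeSign_of_subset_range h1, rowSum_succ_plus, h2, h2]
      simp [unitWeights]
    · have : ¬ mu.erase q ⊆ Finset.range (q + 1) := fun h => hmu fun c hc => by
        by_cases e : c = q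
        · simp [e]
        · exact h (Finset.mem_erase.2 ⟨e, hc⟩)
      simp [hmu, this]
  · simp [hq]

/-- With p above S, all terms share the sums over the columns before p - 1. Expanding columns p - 1
and p leaves an identity in those sums, checked according to which of p - 1 and p are occupied. -/
theorem intertwines_rowOp [CharZero K] (x y : K) : Intertwines x y (rowOp x y) := by
  refine Intertwines.of_max (coeff_ext fun mu => ?_) fun p S hS => coeff_ext fun mu => ?_
  · rw [rowOp_wedge x y (n := 0) (by simp), coeff_wedge]
    simp [rowSum_zero, eq_comm]
  have hins : insert p S ⊆ Finset.range (p + 1) := by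
    rw [Finset.range_add_one]; exact Finset.insert_subset_insert p hS
  have hpS : p ∉ S := fun h => by simpa using hS h
  have hlam : ∀ s, rowSum (unitWeights x y) (insert p S) mu p s =
      rowSum (unitWeights x y) S mu p s := fun s =>
    rowSum_congr _ (fun c hc => by simp [hc.ne]) (fun _ _ => Iff.rfl) s
  have h1 : createPair (-x) p (wedge K S) =
      wedge K (insert p S) + (-x) • shiftedCreate K p (wedge K S) := by
    rw [← create_wedge_of_subset_range hS]; rfl
  have h2 : createPair y p (rowOp x y (wedge K S)) = create K p (rowOp x y (wedge K S)) +
      y • shiftedCreate K p (rowOp x y (wedge K S)) := rfl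
  rw [h1, h2, map_add, map_add, map_add, map_smul, map_smul, map_smul, rowOp_wedge x y hins,
    coeff_create_rowOp x y hS, rowSum_succ_plus, hlam, hlam]
  -- For p = 0 the terms with v_{-1} vanish and only column 0 is left.
  cases p with
  | zero =>
    by_cases hmu : 0 ∈ mu <;> simp [shiftedCreate, hmu, rowSum_zero, unitWeights]
  | succ q =>
    simp only [shiftedCreate]
    rw [coeff_create_rowOp_succ x y hS, create_wedge, rowSum_succ_minus]
    have hlam' : ∀ s, rowSum (unitWeights x y) (insert q S) mu q s =
        rowSum (unitWeights x y) S mu q s := fun s =>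
      rowSum_congr _ (fun c hc => by simp [hc.ne]) (fun _ _ => Iff.rfl) s
    have hsub : mu ⊆ Finset.range (q + 1) ↔ mu ⊆ Finset.range (q + 1 + 1) ∧ q + 1 ∉ mu := by
      constructor
      · intro h
        exact ⟨h.trans (Finset.range_subset_range.2 (by omega)), fun h' => by simpa using h h'⟩
      · rintro ⟨h, h'⟩
        rwa [Finset.range_add_one, Finset.subset_insert_iff_of_notMem h'] at h
    by_cases hqS : q ∈ S
    · by_cases hm : mu ⊆ Finset.range (q + 1 + 1) <;> by_cases hp : q + 1 ∈ mu <;>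
        by_cases hq : q ∈ mu <;> simp [hsub, hm, hp, hq, hqS, unitWeights]
      ring
    · have hS' : S ⊆ Finset.range q := by
        rwa [Finset.range_add_one, Finset.subset_insert_iff_of_notMem hqS] at hS
      have hins' : insert q S ⊆ Finset.range (q + 1) := by
        rw [Finset.range_add_one]; exact Finset.insert_subset_insert q hS'
      rw [wedgeSign_of_subset_range hS', one_smul, if_neg hqS (α := FinWedge K),
        rowOp_wedge x y hins',
        rowSum_succ_plus _ (insert q S), hlam', hlam']
      by_cases hm : mu ⊆ Finset.range (q + 1 + 1) <;> by_cases hp : q + 1 ∈ mu <;>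
        by_cases hq : q ∈ mu <;> simp [hsub, hm, hp, hq, hqS, unitWeights] <;> ring

theorem coeff_apply_eq_sum (X : Module.End K (FinWedge K)) {v : FinWedge K} {s : Finset (Finset ℕ)}
    (hv : ∀ S, S ∉ s → coeff S v = 0) (mu : Finset ℕ) :
    coeff mu (X v) = ∑ S ∈ s, coeff S v * coeff mu (X (wedge K S)) := by
  have : v = ∑ S ∈ s, coeff S v • wedge K S := by
    refine coeff_ext fun U => ?_
    simp only [map_sum, map_smul, coeff_wedge, smul_eq_mul, mul_ite, mul_one, mul_zero]
    rw [Finset.sum_ite_eq']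
    split_ifs with h
    · rfl
    · exact hv U h
  conv_lhs => rw [this]
  simp only [map_sum, map_smul, smul_eq_mul]

theorem coeff_prodOp (x y : ℕ → K) (N : ℕ) {M : ℕ} {lam : Finset ℕ}
    (hlam : lam ⊆ Finset.range (M + 1)) (mu : Finset ℕ) :
    coeff mu (prodOp (fun i => rowOp (x i) (y i)) N (wedge K lam)) =
      if mu ⊆ Finset.range (M + 1) then
        Z (fun i => unitWeights (x i) (y i)) N M lam mu else 0 := by
  induction N generalizing mu with
  | zero =>
    simp only [prodOp, Module.End.one_apply, coeff_wedge]
    by_cases hmu : mu ⊆ Finset.range (M + 1)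
    · rw [if_pos hmu, Z_zero _ hlam hmu]
    · rw [if_neg hmu, if_neg]
      rintro rfl
      exact hmu hlam
  | succ N ih =>
    rw [prodOp, Module.End.mul_apply,
      coeff_apply_eq_sum _ (s := (Finset.range (M + 1)).powerset) (fun S hS => by
        rw [Finset.mem_powerset] at hS
        rw [ih, if_neg hS]), Z_succ]
    split_ifs with hmu
    · refine Finset.sum_congr rfl fun S hS => ?_
      rw [Finset.mem_powerset] at hS
      rw [ih, if_pos hS, rowOp_wedge _ _ hS, if_pos hmu]
    · refine Finset.sum_eq_zero fun S hS => ?_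
      rw [Finset.mem_powerset] at hS
      rw [rowOp_wedge _ _ hS, if_neg hmu, mul_zero]

/-- The partition function with normalised weights is a matrix element of an exponential. -/
theorem Z_unitWeights [CharZero K] (x y : ℕ → K) {t : ℕ → K} (N : ℕ)
    (ht : ∀ k : ℕ, 1 ≤ k → k * t k = ∑ i ∈ Finset.range N, (x i ^ k - (-y i) ^ k)) {M : ℕ}
    {lam mu : Finset ℕ} (hlam : lam ⊆ Finset.range (M + 1)) (hmu : mu ⊆ Finset.range (M + 1)) :
    Z (fun i => unitWeights (x i) (y i)) N M lam mu = coeff mu (expVec t lam) := by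
  rw [← prodOp_wedge (fun i => intertwines_rowOp (x i) (y i)) N ht, coeff_prodOp x y N hlam,
    if_pos hmu]

end Path

/-! ### Fock space and finite wedges -/

section Bridge

variable {K : Type*} [Field K]

/-- The configuration with all negative positions and the positions in `S` occupied. -/
def sea (S : Finset ℕ) : Maya where
  occ := Set.Iio 0 ∪ (Nat.cast '' (S : Set ℕ))
  finite_symmDiff := by
    refine (S.finite_toSet.image (Nat.cast : ℕ → ℤ)).subset ?_
    intro q hq
    simp only [Set.mem_symmDiff, Set.mem_union] at hq
    tauto

theorem mem_sea {S : Finset ℕ} {q : ℤ} : q ∈ (sea S).occ ↔ q < 0 ∨ ∃ c ∈ S, (c : ℤ) = q := by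
  simp [sea]

/-- Fermion operators at nonnegative positions see only S; the filled negative positions are inert.
-/
theorem natCast_mem_sea {S : Finset ℕ} {p : ℕ} : (p : ℤ) ∈ (sea S).occ ↔ p ∈ S := by
  simp [mem_sea]

theorem sea_empty : sea ∅ = Maya.vacuum := by
  ext q; simp [mem_sea, Maya.vacuum]

theorem sea_insert (S : Finset ℕ) (p : ℕ) : (sea S).insert p = sea (insert p S) := by
  ext q
  simp only [Maya.insert, Set.mem_insert_iff, mem_sea, Finset.mem_insert, exists_eq_or_imp]
  grind

theorem sea_erase (S : Finset ℕ) (p : ℕ) : (sea S).erase p = sea (S.erase p) := by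
  ext q
  simp only [Maya.erase, Set.mem_sdiff, Set.mem_singleton_iff, mem_sea, Finset.mem_erase]
  constructor
  · rintro ⟨h | ⟨c, hc, rfl⟩, h2⟩
    · exact Or.inl h
    · exact Or.inr ⟨c, ⟨by simpa using h2, hc⟩, rfl⟩
  · rintro (h | ⟨c, ⟨h2, hc⟩, rfl⟩)
    · exact ⟨Or.inl h, by omega⟩
    · exact ⟨Or.inr ⟨c, hc, rfl⟩, by simpa using h2⟩

theorem sea_injective : Function.Injective sea := by
  intro S T h
  ext p
  rw [← natCast_mem_sea, h, natCast_mem_sea]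

theorem sign_sea (S : Finset ℕ) (p : ℕ) : (sea S).sign K p = wedgeSign K S p := by
  have : {q : ℤ | q ∈ (sea S).occ ∧ (p : ℤ) < q} =
      ((S.filter (p < ·)).map Nat.castEmbedding : Finset ℤ) := by
    ext q
    simp only [mem_sea, Set.mem_ofPred_eq, Finset.coe_map, Set.mem_image, Finset.mem_coe,
      Finset.mem_filter, Nat.castEmbedding_apply]
    constructor
    · rintro ⟨h | ⟨c, hc, rfl⟩, h2⟩
      · omega
      · exact ⟨c, ⟨hc, by exact_mod_cast h2⟩, rfl⟩
    · rintro ⟨c, ⟨hc, h⟩, rfl⟩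
      exact ⟨Or.inr ⟨c, hc, rfl⟩, by exact_mod_cast h⟩
  rw [Maya.sign, this, Set.ncard_coe_finset, Finset.card_map, wedgeSign]

open Classical in
theorem psiStar_single (p : ℤ) (S : Maya) : psiStar K p (Finsupp.single S 1) =
    if p ∈ S.occ then 0 else Finsupp.single (S.insert p) (S.sign K p) := by
  simp [psiStar]

open Classical in
theorem psi_single (p : ℤ) (S : Maya) : psi K p (Finsupp.single S 1) =
    if p ∈ S.occ then Finsupp.single (S.erase p) (S.sign K p) else 0 := by
  simp [psi]

/-- The embedding of finite wedges into Fock space. -/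
def toFock : FinWedge K →ₗ[K] Fock K := lift fun S => Finsupp.single (sea S) 1

theorem toFock_wedge (S : Finset ℕ) : toFock (wedge K S) = Finsupp.single (sea S) 1 :=
  lift_wedge _ _

theorem psiStar_toFock (p : ℕ) (v : FinWedge K) :
    psiStar K p (toFock v) = toFock (create K p v) := by
  have : psiStar K p ∘ₗ toFock = toFock ∘ₗ create K p := by
    refine hom_ext fun S => ?_
    rw [LinearMap.comp_apply, LinearMap.comp_apply, toFock_wedge, psiStar_single, create_wedge,
      sea_insert, sign_sea]
    simp only [natCast_mem_sea]
    split_ifs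
    · simp
    · rw [map_smul, toFock_wedge]; simp
  exact congrArg (· v) this

theorem psi_toFock (p : ℕ) (v : FinWedge K) :
    psi K p (toFock v) = toFock (annihilate K p v) := by
  have : psi K p ∘ₗ toFock = toFock ∘ₗ annihilate K p := by
    refine hom_ext fun S => ?_
    rw [LinearMap.comp_apply, LinearMap.comp_apply, toFock_wedge, psi_single, annihilate_wedge,
      sea_erase, sign_sea]
    simp only [natCast_mem_sea]
    split_ifs
    · rw [map_smul, toFock_wedge]; simp
    · simp
  exact congrArg (· v) this

open Classical in
theorem toFock_apply_sea (v : FinWedge K) (S : Finset ℕ) : toFock v (sea S) = coeff S v := by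
  have : Finsupp.lapply (sea S) ∘ₗ toFock = coeff (K := K) S := by
    refine hom_ext fun T => ?_
    rw [LinearMap.comp_apply, toFock_wedge, coeff_wedge, Finsupp.lapply_apply,
      Finsupp.single_apply]
    by_cases h : T = S
    · simp [h]
    · rw [if_neg h, if_neg fun e => h (sea_injective e)]
  exact congrArg (· v) this

theorem ket_eq (lam : StrictPartition) : ket K lam = Finsupp.single (sea lam) 1 := by
  induction lam using induction_insert_max with
  | empty => simp [ket, vac, sea_empty]
  | insert_max p S hS ih =>
    have hp : p ∉ S := fun h => by simpa using hS h
    have hle : ∀ b ∈ S, p ≥ b := fun b hb => by have := hS hb; simp at this; omega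
    have hS' := ih S (by rw [wt_insert_max hS]; omega)
    rw [ket] at hS' ⊢
    rw [Finset.sort_insert _ hle hp, List.map_cons, List.prod_cons, Module.End.mul_apply, hS',
      ← toFock_wedge, psiStar_toFock, create_wedge_of_subset_range hS, toFock_wedge]

theorem sort_insert_max {p : ℕ} {S : Finset ℕ} (hS : S ⊆ Finset.range p) :
    (insert p S).sort (· ≤ ·) = S.sort (· ≤ ·) ++ [p] := by
  have hp : p ∉ S := fun h => by simpa using hS h
  refine List.Perm.eq_of_pairwise' (r := (· ≤ ·)) (Finset.pairwise_sort _ _) ?_ ?_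
  · rw [List.pairwise_append]
    refine ⟨Finset.pairwise_sort _ _, by simp, fun a ha b hb => ?_⟩
    simp only [Finset.mem_sort, List.mem_singleton] at ha hb
    have := hS ha
    simp at this; omega
  · rw [← Multiset.coe_eq_coe, Finset.sort_eq, ← Multiset.coe_add, Finset.sort_eq,
      Finset.insert_val_of_notMem hp, add_comm]
    rfl

/-- With p above S the sign is 1, so the successive annihilations in a bra read off a coefficient
without sign. -/
theorem psi_apply_sea {p : ℕ} {S : Finset ℕ} (hS : S ⊆ Finset.range p) (v : Fock K) :
    psi K p v (sea S) = v (sea (insert p S)) := by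
  have hp : p ∉ S := fun h => by simpa using hS h
  have : Finsupp.lapply (sea S) ∘ₗ psi K p = Finsupp.lapply (R := K) (sea (insert p S)) := by
    refine Finsupp.lhom_ext' fun T => LinearMap.ext_ring ?_
    change psi K p (Finsupp.single T 1) (sea S) = Finsupp.single T 1 (sea (insert p S))
    rw [psi_single]
    by_cases hT : T = sea (insert p S)
    · subst hT
      rw [if_pos (natCast_mem_sea.2 (Finset.mem_insert_self p S)), sea_erase,
        Finset.erase_insert hp, sign_sea, wedgeSign_insert hp, if_neg (lt_irrefl p),
        wedgeSign_of_subset_range hS]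
      simp
    · rw [Finsupp.single_eq_of_ne (Ne.symm hT)]
      split_ifs with h
      · refine Finsupp.single_eq_of_ne fun e => hT ?_
        rw [← sea_insert, e]
        ext q
        simp only [Maya.insert, Maya.erase, Set.mem_insert_iff, Set.mem_sdiff,
          Set.mem_singleton_iff]
        by_cases hq : q = p
        · subst hq; simpa using h
        · simp [hq]
      · rfl
  exact congrArg (· v) this

theorem bra_eq (lam : StrictPartition) (v : Fock K) : bra K lam v = v (sea lam) := by
  induction lam using induction_insert_max generalizing v with
  | empty => simp [bra, sea_empty]
  | insert_max p S hS ih =>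
    have hS' := ih S (by rw [wt_insert_max hS]; omega)
    rw [← psi_apply_sea hS, ← hS', bra, sort_insert_max hS, List.map_append, List.prod_append]
    simp [bra]

/-! ### Current operators and the expansion of the exponential. -/

theorem normalOrdered_of_ne {i j : ℤ} (h : j ≠ i) :
    normalOrdered K j i = psiStar K j * psi K i := by
  have : vacuumExpectation K (psiStar K j * psi K i) = 0 := by
    rw [vacuumExpectation, Module.End.mul_apply, vac, psi_single]
    split_ifs with h1
    · rw [← mul_one (Maya.sign K _ _), ← smul_eq_mul, ← Finsupp.smul_single, map_smul,
        psiStar_single]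
      split_ifs with h2
      · simp
      · rw [Finsupp.smul_apply, Finsupp.single_eq_of_ne, smul_zero]
        intro e
        have : i ∈ ((Maya.vacuum.erase i).insert j).occ := e ▸ h1
        simp [Maya.insert, Maya.erase, h.symm] at this
    · simp
  rw [normalOrdered, this, zero_smul]
  exact sub_zero (psiStar K j * psi K i)

theorem current_single (n : ℤ) (hn : n ≠ 0) (S : Maya) : current K n (Finsupp.single S 1) =
    ∑ᶠ i : ℤ, psiStar K (i - n) (psi K i (Finsupp.single S 1)) := by
  rw [current, Finsupp.linearCombination_single, one_smul]
  refine finsum_congr fun i => ?_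
  rw [normalOrdered_of_ne (by omega), Module.End.mul_apply]

theorem mem_of_psiStar_psi_ne_zero {i j : ℤ} {S : Maya} (hij : j ≠ i)
    (h : psiStar K j (psi K i (Finsupp.single S 1)) ≠ 0) : i ∈ S.occ ∧ j ∉ S.occ := by
  rw [psi_single] at h
  by_cases hi : i ∈ S.occ
  · refine ⟨hi, fun hj => h ?_⟩
    rw [if_pos hi, ← mul_one (Maya.sign K _ _), ← smul_eq_mul, ← Finsupp.smul_single, map_smul,
      psiStar_single, if_pos, smul_zero]
    exact ⟨hj, hij⟩
  · rw [if_neg hi, map_zero] at h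
    exact absurd rfl h

/-- The operator `J_k` on finite wedges. -/
def finCurrent (K : Type*) [Field K] (k : ℕ) : Module.End K (FinWedge K) := ham (Pi.single k 1)

theorem finCurrent_wedge {k : ℕ} (hk : 1 ≤ k) (S : Finset ℕ) : finCurrent K k (wedge K S) =
    ∑ p ∈ S.filter (k ≤ ·), create K (p - k) (annihilate K p (wedge K S)) := by
  rw [finCurrent, ham_wedge, Finset.sum_filter]
  refine Finset.sum_congr rfl fun p _ => ?_
  split_ifs with h
  · rw [Finset.sum_eq_single k]
    · simp
    · intro j _ hj; simp [hj]
    · intro h'; exact absurd (Finset.mem_Icc.2 ⟨hk, h⟩) h'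
  · refine Finset.sum_eq_zero fun j hj => ?_
    rw [Finset.mem_Icc] at hj
    simp [show j ≠ k by omega]

/-- For k ≥ 1 particles move down, and a particle at a negative position only finds occupied
targets. So the finite wedges are stable, and only particles at p ≥ k can jump. -/
theorem current_toFock {k : ℕ} (hk : 1 ≤ k) (v : FinWedge K) :
    current K k (toFock v) = toFock (finCurrent K k v) := by
  have : current K k ∘ₗ toFock = toFock ∘ₗ finCurrent K k := by
    refine hom_ext fun S => ?_
    rw [LinearMap.comp_apply, LinearMap.comp_apply, toFock_wedge, current_single _ (by omega),
      finCurrent_wedge hk, finsum_eq_sum_of_support_subset (s :=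
        (S.filter (k ≤ ·)).map Nat.castEmbedding), Finset.sum_map, map_sum]
    · refine Finset.sum_congr rfl fun p hp => ?_
      rw [Finset.mem_filter] at hp
      rw [Nat.castEmbedding_apply, ← toFock_wedge, psi_toFock, ← Nat.cast_sub hp.2,
        psiStar_toFock]
    · intro i hi
      obtain ⟨h1, h2⟩ := mem_of_psiStar_psi_ne_zero (by omega) hi
      rw [mem_sea] at h1 h2
      push Not at h2
      rcases h1 with h1 | ⟨c, hc, rfl⟩
      · omega
      · simp only [Finset.coe_map, Set.mem_image, Finset.mem_coe, Finset.mem_filter,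
          Nat.castEmbedding_apply]
        exact ⟨c, ⟨hc, by omega⟩, rfl⟩
  exact congrArg (· v) this

theorem prod_current_toFock {m : ℕ} (k : Fin m → ℕ+) (v : FinWedge K) :
    (List.ofFn fun i => current K (1 * (k i : ℤ))).prod (toFock v) =
      toFock ((List.ofFn fun i => finCurrent K (k i)).prod v) := by
  induction m with
  | zero => simp
  | succ m ih =>
    rw [List.ofFn_succ, List.ofFn_succ, List.prod_cons, List.prod_cons, Module.End.mul_apply,
      Module.End.mul_apply, ih, one_mul]
    exact current_toFock (k 0).2 _

theorem finCurrent_mem (k : ℕ) {n : ℕ} {v : FinWedge K} (hv : v ∈ lowWeight K n) :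
    finCurrent K k v ∈ lowWeight K n :=
  ham_mem _ (lowWeight_mono n.le_succ hv)

theorem prod_finCurrent_mem {m : ℕ} (k : Fin m → ℕ) {n : ℕ} {v : FinWedge K}
    (hv : v ∈ lowWeight K n) : (List.ofFn fun i => finCurrent K (k i)).prod v ∈ lowWeight K n := by
  induction m with
  | zero => simpa using hv
  | succ m ih =>
    rw [List.ofFn_succ, List.prod_cons, Module.End.mul_apply]
    exact finCurrent_mem _ (ih _)

theorem lt_wt_of_mem {S : Finset ℕ} {p : ℕ} (hp : p ∈ S) : p < wt S :=
  Finset.single_le_sum (f := (· + 1)) (fun _ _ => Nat.zero_le _) hp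

theorem finCurrent_eq_zero {k n : ℕ} (h : n < k) {v : FinWedge K} (hv : v ∈ lowWeight K n) :
    finCurrent K k v = 0 := by
  refine eq_zero_on_lowWeight (fun S hS => ?_) hv
  rw [finCurrent_wedge (by omega), Finset.filter_eq_empty_iff.2, Finset.sum_empty]
  intro p hp
  have := lt_wt_of_mem hp
  omega

/-- No particle of a wedge of weight below n can jump by more than n, and the other currents do not
raise the weight. This bounds the support of the sum over the k's. -/
theorem prod_finCurrent_eq_zero {m : ℕ} (k : Fin m → ℕ) {n : ℕ} (i : Fin m) (h : n < k i)
    {v : FinWedge K} (hv : v ∈ lowWeight K n) :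
    (List.ofFn fun i => finCurrent K (k i)).prod v = 0 := by
  induction m with
  | zero => exact i.elim0
  | succ m ih =>
    rw [List.ofFn_succ, List.prod_cons, Module.End.mul_apply]
    induction i using Fin.cases with
    | zero => exact finCurrent_eq_zero h (prod_finCurrent_mem _ hv)
    | succ i => rw [ih (fun i => k i.succ) i h, map_zero]

theorem ham_eq_sum_finCurrent (t : ℕ → K) {n : ℕ} {v : FinWedge K} (hv : v ∈ lowWeight K n) :
    ham t v = ∑ j : Fin n, t (j + 1) • finCurrent K (j + 1) v := by
  have := eq_zero_on_lowWeight
    (X := ham t - ∑ j : Fin n, t (j + 1) • finCurrent K (j + 1)) (n := n) (fun S hS => ?_) hv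
  · rw [LinearMap.sub_apply, sub_eq_zero] at this
    simpa using this
  rw [LinearMap.sub_apply, sub_eq_zero, ham_wedge]
  simp only [LinearMap.sum_apply, LinearMap.smul_apply]
  rw [Fin.sum_univ_eq_sum_range (fun j => t (j + 1) • finCurrent K (j + 1) (wedge K S)) n]
  have : ∀ j, finCurrent K (j + 1) (wedge K S) =
      ∑ p ∈ S, if j + 1 ≤ p then create K (p - (j + 1)) (annihilate K p (wedge K S)) else 0 := by
    intro j
    rw [finCurrent_wedge (by omega), Finset.sum_filter]
  simp only [this, Finset.smul_sum]
  rw [Finset.sum_comm]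
  refine Finset.sum_congr rfl fun p hp => ?_
  have hpn := lt_wt_of_mem hp
  simp only [smul_ite, smul_zero]
  rw [← Finset.sum_filter]
  refine (Finset.sum_bij (fun j _ => j + 1) ?_ ?_ ?_ ?_).symm
  · intro j hj; simp at hj ⊢; omega
  · intro i _ j _ h; simpa using h
  · intro k hk
    rw [Finset.mem_Icc] at hk
    exact ⟨k - 1, by simp; omega, by omega⟩
  · intro j _; rfl

theorem ham_pow_eq_sum (t : ℕ → K) {n : ℕ} (m : ℕ) {v : FinWedge K} (hv : v ∈ lowWeight K n) :
    (ham t ^ m) v = ∑ k : Fin m → Fin n, (∏ i, t (k i + 1)) •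
      (List.ofFn fun i => finCurrent K (k i + 1)).prod v := by
  induction m with
  | zero => simp
  | succ m ih =>
    have hmem : (ham t ^ m) v ∈ lowWeight K n :=
      ham_pow_mem t m (lowWeight_mono (by omega) hv)
    rw [pow_succ', Module.End.mul_apply, ham_eq_sum_finCurrent t hmem, ih,
      ← (Fin.consEquiv fun _ : Fin (m + 1) => Fin n).sum_comp, Fintype.sum_prod_type]
    refine Finset.sum_congr rfl fun j _ => ?_
    rw [map_sum, Finset.smul_sum]
    refine Finset.sum_congr rfl fun k _ => ?_
    simp [Fin.consEquiv, Fin.prod_univ_succ, List.ofFn_succ, smul_smul]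

theorem finsum_prod_finCurrent (t : ℕ → K) (m : ℕ) (α β : Finset ℕ) :
    ∑ᶠ k : Fin m → ℕ+, (∏ i, t (k i)) *
      coeff α ((List.ofFn fun i => finCurrent K (k i)).prod (wedge K β)) =
      coeff α ((ham t ^ m) (wedge K β)) := by
  have hβ : wedge K β ∈ lowWeight K (wt β + 1) := wedge_mem_lowWeight (Nat.lt_succ_self _)
  let e : (Fin m → Fin (wt β + 1)) → (Fin m → ℕ+) := fun k i => Nat.succPNat (k i)
  have he : Function.Injective e := fun k l h => funext fun i => by
    have := congrFun h i
    exact Fin.val_injective (Nat.succPNat_injective this)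
  rw [finsum_eq_sum_of_support_subset (s := Finset.univ.map ⟨e, he⟩), Finset.sum_map,
    ham_pow_eq_sum t m hβ, map_sum]
  · simp [e]
  · intro k hk
    simp only [Finset.coe_map, Finset.coe_univ, Set.image_univ, Set.mem_range,
      Function.Embedding.coeFn_mk]
    have hlt : ∀ i, (k i : ℕ) ≤ wt β + 1 := by
      intro i
      by_contra h
      refine hk ?_
      beta_reduce
      rw [prod_finCurrent_eq_zero (fun i => (k i : ℕ)) i (not_le.1 h) hβ, map_zero, mul_zero]
    refine ⟨fun i => ⟨k i - 1, ?_⟩, funext fun i => PNat.eq ?_⟩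
    · have := hlt i
      have := (k i).pos
      omega
    · have := (k i).pos
      simp only [e, Nat.succPNat_coe]
      omega

theorem expElement_one (t : ℕ → K) (α β : StrictPartition) :
    expElement 1 (fun k => t k) α β = coeff α (expVec t β) := by
  have h : ∀ (m : ℕ) (k : Fin m → ℕ+),
      bra K α ((List.ofFn fun i => current K (1 * (k i : ℤ))).prod (ket K β)) =
        coeff α ((List.ofFn fun i => finCurrent K (k i)).prod (wedge K β)) := by
    intro m k
    rw [bra_eq, ket_eq, ← toFock_wedge, prod_current_toFock, toFock_apply_sea]
  simp only [expElement, h, finsum_prod_finCurrent]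
  rw [finsum_eq_sum_of_support_subset (s := Finset.range (wt β + 1)), expVec, map_sum]
  · simp
  · intro m hm
    rw [Finset.mem_coe, Finset.mem_range]
    by_contra h
    exact hm (by beta_reduce; rw [ham_pow_wedge_eq_zero t (by omega), map_zero, mul_zero])

/-! ### Adjoints -/

/-- The symmetric bilinear form on Fock space with orthonormal basis vectors. -/
def pairing : Fock K →ₗ[K] Fock K →ₗ[K] K :=
  Finsupp.linearCombination K fun S => Finsupp.lapply S

theorem pairing_single (S : Maya) (v : Fock K) : pairing (Finsupp.single S 1) v = v S := by
  simp [pairing]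

open Classical in
theorem pairing_comm (u v : Fock K) : pairing u v = pairing v u := by
  have : (pairing : Fock K →ₗ[K] Fock K →ₗ[K] K) = pairing.flip := by
    refine Finsupp.lhom_ext' fun S => LinearMap.ext_ring (Finsupp.lhom_ext' fun T =>
      LinearMap.ext_ring ?_)
    change pairing (Finsupp.single S 1) (Finsupp.single T 1) =
      pairing (Finsupp.single T 1) (Finsupp.single S 1)
    rw [pairing_single, pairing_single, Finsupp.single_apply, Finsupp.single_apply]
    simp only [eq_comm]
  exact congrArg (fun f => f u v) this

theorem pairing_adjoint {X Y : Module.End K (Fock K)}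
    (h : ∀ S T, X (Finsupp.single S 1) T = Y (Finsupp.single T 1) S) (u v : Fock K) :
    pairing (X u) v = pairing u (Y v) := by
  have : pairing ∘ₗ X = (pairing (K := K)).compl₂ Y := by
    refine Finsupp.lhom_ext' fun S => LinearMap.ext_ring (Finsupp.lhom_ext' fun T =>
      LinearMap.ext_ring ?_)
    change pairing (X (Finsupp.single S 1)) (Finsupp.single T 1) =
      pairing (Finsupp.single S 1) (Y (Finsupp.single T 1))
    rw [pairing_comm, pairing_single, pairing_single, h]
  exact congrArg (fun f => f u v) this

open Classical in
theorem psi_single_apply (p : ℤ) (S T : Maya) :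
    psi K p (Finsupp.single S 1) T = psiStar K p (Finsupp.single T 1) S := by
  rw [psi_single, psiStar_single]
  by_cases h : p ∈ S.occ ∧ S.erase p = T
  · obtain ⟨h1, rfl⟩ := h
    have h2 : p ∉ (S.erase p).occ := by simp [Maya.erase]
    have h3 : (S.erase p).insert p = S := by
      ext q
      by_cases hq : q = p
      · subst hq; simpa [Maya.insert] using h1
      · simp [Maya.insert, Maya.erase, hq]
    have h4 : (S.erase p).sign K p = S.sign K p := by
      rw [Maya.sign, Maya.sign]
      congr 2
      ext q
      simp only [Maya.erase, Set.mem_sdiff, Set.mem_singleton_iff, Set.mem_ofPred_eq]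
      exact ⟨fun h => ⟨h.1.1, h.2⟩, fun h => ⟨⟨h.1, h.2.ne'⟩, h.2⟩⟩
    rw [if_pos h1, if_neg h2, h3, h4, Finsupp.single_eq_same, Finsupp.single_eq_same]
  · have e1 : (if p ∈ S.occ then Finsupp.single (S.erase p) (S.sign K p) else 0) T = 0 := by
      split_ifs with h1
      · exact Finsupp.single_eq_of_ne fun e => h ⟨h1, e.symm⟩
      · rfl
    have e2 : (if p ∈ T.occ then 0 else Finsupp.single (T.insert p) (T.sign K p)) S = 0 := by
      split_ifs with h1
      · rfl
      · refine Finsupp.single_eq_of_ne fun e => h ?_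
        subst e
        refine ⟨by simp [Maya.insert], ?_⟩
        ext q
        by_cases hq : q = p
        · subst hq; simpa [Maya.insert, Maya.erase] using h1
        · simp [Maya.insert, Maya.erase, hq]
    rw [e1, e2]

theorem pairing_psi (p : ℤ) (u v : Fock K) : pairing (psi K p u) v = pairing u (psiStar K p v) :=
  pairing_adjoint (psi_single_apply p) u v

theorem pairing_psiStar (p : ℤ) (u v : Fock K) :
    pairing (psiStar K p u) v = pairing u (psi K p v) := by
  rw [pairing_comm, ← pairing_psi, pairing_comm]

theorem finite_support_psiStar_psi {n : ℤ} (hn : n ≠ 0) (S : Maya) :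
    (Function.support fun i : ℤ => psiStar K (i - n) (psi K i (Finsupp.single S 1))).Finite := by
  have h2 : ((fun i : ℤ => i - n) ⁻¹' symmDiff S.occ (Set.Iio 0)).Finite :=
    S.finite_symmDiff.preimage (sub_left_injective.injOn)
  refine ((S.finite_symmDiff.union h2).union (Set.finite_Icc (-|n|) |n|)).subset fun i hi => ?_
  obtain ⟨h1, h2⟩ := mem_of_psiStar_psi_ne_zero (by omega) hi
  simp only [Set.mem_union, Set.mem_symmDiff, Set.mem_preimage, Set.mem_Iio, Set.mem_Icc, h1, h2,
    not_true, not_false_iff, true_and, and_true, false_and, and_false, or_false, false_or]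
  grind

theorem current_single_apply {n : ℤ} (hn : n ≠ 0) (S T : Maya) :
    current K n (Finsupp.single S 1) T = current K (-n) (Finsupp.single T 1) S := by
  rw [current_single n hn, current_single (-n) (neg_ne_zero.2 hn)]
  change Finsupp.lapply (R := K) T _ = Finsupp.lapply (R := K) S _
  -- The move from i to i - n is adjoint to the reverse one, which the current for -n lists under i
  -- - n; hence the shift of the index by n.
  rw [map_finsum _ (finite_support_psiStar_psi hn S),
    map_finsum _ (finite_support_psiStar_psi (neg_ne_zero.2 hn) T),
    ← finsum_comp_equiv (Equiv.addRight n)]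
  refine finsum_congr fun i => ?_
  rw [Finsupp.lapply_apply, Finsupp.lapply_apply, ← pairing_single, pairing_comm,
    pairing_psiStar, pairing_psi, pairing_single]
  simp

theorem pairing_prod_current {n : List ℤ} (hn : ∀ k ∈ n, k ≠ 0) (u v : Fock K) :
    pairing u ((n.map fun k => current K k).prod v) =
      pairing ((n.reverse.map fun k => current K (-k)).prod u) v := by
  induction n generalizing u with
  | nil => simp
  | cons k n ih =>
    rw [List.map_cons, List.prod_cons, Module.End.mul_apply, pairing_comm,
      pairing_adjoint (current_single_apply (hn k (by simp))), pairing_comm,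
      ih fun k hk => hn k (List.mem_cons_of_mem _ hk)]
    simp

/-- J_{-k} can lift particles out of the filled sea and so leave the finite wedges. Passing to
adjoints reduces it to J_k, with the order of the factors reversed. -/
theorem expElement_neg_one (t : ℕ+ → K) (α β : StrictPartition) :
    expElement (-1) t α β = expElement 1 t β α := by
  have h : ∀ (m : ℕ) (k : Fin m → ℕ+),
      bra K α ((List.ofFn fun i => current K (-1 * (k i : ℤ))).prod (ket K β)) =
        bra K β ((List.ofFn fun i => current K (1 * (k i.rev : ℤ))).prod (ket K α)) := by
    intro m k
    rw [bra_eq, bra_eq, ket_eq, ket_eq, ← pairing_single (K := K) (sea α),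
      ← pairing_single (K := K) (sea β), pairing_comm (Finsupp.single (sea β) 1)]
    have h1 : (List.ofFn fun i => current K (-1 * (k i : ℤ))) =
        (List.ofFn fun i => (-1 * (k i : ℤ))).map fun k => current K k := by
      rw [List.map_ofFn]; rfl
    have h2 : (List.ofFn fun i => current K (1 * (k i.rev : ℤ))) =
        (List.ofFn fun i => (-1 * (k i : ℤ))).reverse.map fun k => current K (-k) := by
      refine List.ext_getElem (by simp) fun i h₁ h₂ => ?_
      simp only [List.getElem_ofFn, List.getElem_map, List.getElem_reverse, List.length_ofFn]
      congr 1
      rw [neg_mul, neg_neg]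
      congr 4
      ext
      simp only [Fin.val_rev]
      omega
    rw [h1, h2, pairing_prod_current]
    intro n hn
    rw [List.mem_ofFn] at hn
    obtain ⟨i, rfl⟩ := hn
    have := (k i).pos
    omega
  rw [expElement, expElement]
  refine finsum_congr fun m => ?_
  congr 1
  -- The reversal only permutes the summation indices and leaves the product of the parameters
  -- unchanged.
  rw [← finsum_comp_equiv (Equiv.arrowCongr Fin.revPerm (Equiv.refl ℕ+))]
  refine finsum_congr fun k => ?_
  rw [h]
  congr 1
  · exact Equiv.prod_comp Fin.revPerm fun i => t (k i)
  · simp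

end Bridge

/-! ### Matching with exponentials -/

section Matching

variable {K : Type*} [Field K]

/-- The matrix elements of the exponentials with parameters `u j k` match the partition functions
with row weights `W`. -/
def ExpMatches (W : ℕ → Weights K) (u : ℕ → ℕ → K) (C : ℕ → ℕ → ℕ → K) : Prop :=
  ∀ (N M : ℕ) (lam mu : Finset ℕ), lam ⊆ Finset.range (M + 1) → mu ⊆ Finset.range (M + 1) →
    Z W N M lam mu =
      C N M lam.card * coeff mu (expVec (fun k => ∑ j ∈ Finset.range N, u j k) lam)

theorem subset_range_succ_iff {S : Finset ℕ} {M : ℕ} :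
    S ⊆ Finset.range (M + 1) ↔ ∀ p ∈ S, p ≤ M := by
  simp only [Finset.subset_iff, Finset.mem_range, Nat.lt_succ_iff]

theorem matches_iff (W : ℕ → Weights K) (s : ℕ → ℤ → K) (C : ℕ → ℕ → ℕ → K) :
    Matches W s C ↔ ExpMatches W (fun j k => s j k) C := by
  have h : ∀ N α β, expPlus s N α β =
      coeff α (expVec (fun k : ℕ => ∑ j ∈ Finset.range N, s j k) β) := fun N α β =>
    expElement_one (fun k : ℕ => ∑ j ∈ Finset.range N, s j k) α β
  simp only [Matches, ExpMatches, h, subset_range_succ_iff]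

/-- The weights with `c₁` and `c₂` exchanged. -/
def Weights.swap (w : Weights K) : Weights K := { w with c₁ := w.c₂, c₂ := w.c₁ }

/-- A reflection in a horizontal line. It also turns the row numbering from top to bottom into the
one from bottom to top. -/
theorem Weights.dualVertex_eq (w : Weights K) (l t r b : Spin) :
    w.dualVertex l t r b = w.swap.vertex l b r t := by
  cases l <;> cases t <;> cases r <;> cases b <;> rfl

theorem dualZ_eq (W : ℕ → Weights K) (N M : ℕ) (lam mu : Finset ℕ) :
    dualZ W N M lam mu = Z (fun i => (W i).swap) N M lam mu := by
  simp only [dualZ, Z, Weights.dualVertex_eq]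

theorem dualMatches_iff (W : ℕ → Weights K) (s : ℕ → ℤ → K) (C : ℕ → ℕ → ℕ → K) :
    DualMatches W s C ↔ ExpMatches (fun i => (W i).swap) (fun j k => s j (-k)) C := by
  have h : ∀ N α β, expMinus s N α β =
      coeff β (expVec (fun k : ℕ => ∑ j ∈ Finset.range N, s j (-k)) α) := fun N α β =>
    (expElement_neg_one _ α β).trans
      (expElement_one (fun k : ℕ => ∑ j ∈ Finset.range N, s j (-k)) β α)
  simp only [DualMatches, ExpMatches, h, subset_range_succ_iff, dualZ_eq]

theorem expMatches_gauge {W W' : ℕ → Weights K} (ha₁ : ∀ i, (W i).a₁ = (W' i).a₁)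
    (ha₂ : ∀ i, (W i).a₂ = (W' i).a₂) (hb₁ : ∀ i, (W i).b₁ = (W' i).b₁)
    (hb₂ : ∀ i, (W i).b₂ = (W' i).b₂) (hc : ∀ i, (W i).c₁ * (W i).c₂ = (W' i).c₁ * (W' i).c₂)
    (u : ℕ → ℕ → K) (C : ℕ → ℕ → ℕ → K) : ExpMatches W u C ↔ ExpMatches W' u C := by
  simp only [ExpMatches, Z_gauge ha₁ ha₂ hb₁ hb₂ hc]

theorem expMatches_weights [CharZero K] (x y A B : ℕ → K) {u : ℕ → ℕ → K}
    (hu : ∀ j, ∀ k : ℕ, 1 ≤ k → u j k = (x j ^ k + (-1) ^ (k - 1) * y j ^ k) / k) :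
    ExpMatches (weights x y A B) u (factor A B) := by
  intro N M lam mu hlam hmu
  rw [Z_weights x y A B N hlam hmu, Z_unitWeights x y N (fun k hk => ?_) hlam hmu]
  rw [Finset.mul_sum]
  refine Finset.sum_congr rfl fun j _ => ?_
  have hk0 : (k : K) ≠ 0 := by exact_mod_cast (by omega : k ≠ 0)
  obtain ⟨k, rfl⟩ := Nat.exists_eq_add_of_le' hk
  rw [hu j _ hk, mul_div_cancel₀ _ hk0, neg_pow (y j), Nat.add_sub_cancel, pow_succ (-1 : K)]
  ring

theorem factor_ne_zero {A B : ℕ → K} (h : ∀ i, A i ≠ 0 ∧ B i ≠ 0) (N M l : ℕ) :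
    factor A B N M l ≠ 0 :=
  Finset.prod_ne_zero_iff.2 fun i _ => mul_ne_zero (pow_ne_zero _ (h i).1) (pow_ne_zero _ (h i).2)

/-! ### Uniqueness of the parameters, from a single particle. -/

theorem annihilate_singleton (q : ℕ) : annihilate K q (wedge K {q}) = wedge K ∅ := by
  simp [annihilate_wedge, wedgeSign, Finset.filter_singleton]

theorem create_empty (q : ℕ) : create K q (wedge K ∅) = wedge K {q} := by
  simp [create_wedge, wedgeSign]

theorem ham_singleton (t : ℕ → K) (q : ℕ) :
    ham t (wedge K {q}) = ∑ k ∈ Finset.Icc 1 q, t k • wedge K {q - k} := by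
  rw [ham_wedge, Finset.sum_singleton]
  simp only [annihilate_singleton, create_empty]

theorem ham_pow_singleton_congr {t t' : ℕ → K} {n : ℕ} (h : ∀ k, 1 ≤ k → k < n → t k = t' k)
    (m : ℕ) {q : ℕ} (hq : q < n) : (ham t ^ m) (wedge K {q}) = (ham t' ^ m) (wedge K {q}) := by
  induction m generalizing q with
  | zero => rfl
  | succ m ih =>
    rw [pow_succ, pow_succ, Module.End.mul_apply, Module.End.mul_apply, ham_singleton,
      ham_singleton, map_sum, map_sum]
    refine Finset.sum_congr rfl fun k hk => ?_
    rw [Finset.mem_Icc] at hk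
    rw [map_smul, map_smul, h k hk.1 (by omega), ih (by omega)]

/-- The parameter at n enters only through the direct jump from n to 0, after which the particle
cannot move. -/
theorem ham_pow_succ_singleton_sub {t t' : ℕ → K} {n : ℕ} (hn : 1 ≤ n)
    (h : ∀ k, 1 ≤ k → k < n → t k = t' k) (m : ℕ) :
    (ham t ^ (m + 1)) (wedge K {n}) - (ham t' ^ (m + 1)) (wedge K {n}) =
      if m = 0 then (t n - t' n) • wedge K {0} else 0 := by
  have h0 : ∀ m, (ham t ^ m) (wedge K {0}) = if m = 0 then wedge K {0} else 0 := by
    intro m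
    cases m with
    | zero => simp
    | succ m => simp [pow_succ, ham_singleton]
  rw [pow_succ, pow_succ, Module.End.mul_apply, Module.End.mul_apply, ham_singleton, ham_singleton,
    map_sum, map_sum, ← Finset.sum_sub_distrib, Finset.sum_eq_single n]
  · rw [map_smul, map_smul, Nat.sub_self, ← ham_pow_singleton_congr h m (by omega), ← sub_smul, h0]
    split_ifs <;> simp
  · intro k hk hkn
    rw [Finset.mem_Icc] at hk
    rw [map_smul, map_smul, h k hk.1 (by omega), ham_pow_singleton_congr h m (by omega), sub_self]
  · intro h'
    exact absurd (Finset.mem_Icc.2 ⟨hn, le_rfl⟩) h'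

theorem expVec_singleton_sub {t t' : ℕ → K} {n : ℕ} (hn : 1 ≤ n)
    (h : ∀ k, 1 ≤ k → k < n → t k = t' k) :
    expVec t {n} - expVec t' {n} = (t n - t' n) • wedge K {0} := by
  rw [expVec, expVec, ← Finset.sum_sub_distrib, Finset.sum_range_succ']
  simp only [← smul_sub, ham_pow_succ_singleton_sub hn h, pow_zero, sub_self, smul_zero, add_zero,
    smul_ite]
  rw [Finset.sum_ite_eq' (Finset.range (wt {n})) 0, if_pos (by simp [wt])]
  simp

theorem expVec_injective {t t' : ℕ → K}
    (h : ∀ n, coeff {0} (expVec t {n}) = coeff {0} (expVec t' {n})) (k : ℕ) (hk : 1 ≤ k) :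
    t k = t' k := by
  induction k using Nat.strong_induction_on with
  | _ k ih =>
    have := congrArg (coeff {0}) (expVec_singleton_sub hk fun l hl hlk => ih l hlk hl)
    rw [map_sub, h, sub_self, map_smul, coeff_wedge, if_pos rfl, smul_eq_mul, mul_one] at this
    exact (sub_eq_zero.1 this.symm)

/-- One-particle amplitudes determine the sums of the parameters over the first N rows; consecutive
N then separate the rows. -/
theorem ExpMatches.unique {W : ℕ → Weights K} {u u' : ℕ → ℕ → K} {C : ℕ → ℕ → ℕ → K}
    (hC : ∀ N M l, C N M l ≠ 0) (h : ExpMatches W u C) (h' : ExpMatches W u' C) (j k : ℕ)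
    (hk : 1 ≤ k) : u j k = u' j k := by
  have key : ∀ N, ∑ j ∈ Finset.range N, u j k = ∑ j ∈ Finset.range N, u' j k := by
    intro N
    refine expVec_injective (t := fun k => ∑ j ∈ Finset.range N, u j k)
      (t' := fun k => ∑ j ∈ Finset.range N, u' j k) (fun n => ?_) k hk
    have hn : ({n} : Finset ℕ) ⊆ Finset.range (n + 1) := by simp
    have h0 : ({0} : Finset ℕ) ⊆ Finset.range (n + 1) := by simp
    exact mul_left_cancel₀ (hC N n ({n} : Finset ℕ).card)
      ((h N n {n} {0} hn h0).symm.trans (h' N n {n} {0} hn h0))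
  have h1 := key (j + 1)
  rw [Finset.sum_range_succ, Finset.sum_range_succ, key j] at h1
  exact add_left_cancel h1

theorem expMatches_weights_iff [CharZero K] (x y A B : ℕ → K) (u : ℕ → ℕ → K)
    (h : ∀ i, A i ≠ 0 ∧ B i ≠ 0) : ExpMatches (weights x y A B) u (factor A B) ↔
      ∀ j, ∀ k : ℕ, 1 ≤ k → u j k = (x j ^ k + (-1) ^ (k - 1) * y j ^ k) / k :=
  ⟨fun hu j k hk => hu.unique (factor_ne_zero h)
    (expMatches_weights x y A B (u := fun j k => (x j ^ k + (-1) ^ (k - 1) * y j ^ k) / k)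
      fun _ _ _ => rfl) j k hk, expMatches_weights x y A B⟩

/-! ### Small exponentials -/

theorem expVec_of_ham_eq_zero {t : ℕ → K} {β : Finset ℕ} (h : ham t (wedge K β) = 0) :
    expVec t β = wedge K β := by
  rw [expVec, Finset.sum_range_succ']
  simp [pow_succ, h]

theorem ham_pair_zero_one (t : ℕ → K) : ham t (wedge K {0, 1}) = 0 := by
  rw [ham_wedge]
  simp [annihilate_wedge, create_wedge, Finset.erase_insert_of_ne]

theorem ham_pair_zero_two (t : ℕ → K) : ham t (wedge K {0, 2}) = t 1 • wedge K {0, 1} := by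
  have h1 : (Finset.Icc 1 2 : Finset ℕ) = {1, 2} := by decide
  have h2 : ({0, 2} : Finset ℕ).erase 2 = {0} := by decide
  have h3 : (insert 1 {0} : Finset ℕ) = {0, 1} := by decide
  rw [ham_wedge]
  simp [annihilate_wedge, create_wedge, wedgeSign, h1, h2, h3, Finset.filter_insert,
    Finset.filter_singleton]

theorem ham_pair_one_two (t : ℕ → K) :
    ham t (wedge K {1, 2}) = t 1 • wedge K {0, 2} - t 2 • wedge K {0, 1} := by
  have h1 : (Finset.Icc 1 2 : Finset ℕ) = {1, 2} := by decide
  have h2 : ({1, 2} : Finset ℕ).erase 2 = {1} := by decide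
  have h3 : ({1, 2} : Finset ℕ).erase 1 = {2} := by decide
  rw [ham_wedge]
  simp [annihilate_wedge, create_wedge, wedgeSign, h1, h2, h3, Finset.filter_insert,
    Finset.filter_singleton, sub_eq_add_neg]

theorem expVec_singleton_one (t : ℕ → K) :
    expVec t {1} = wedge K {1} + t 1 • wedge K {0} := by
  simp [expVec, wt, Finset.sum_range_succ, pow_succ, ham_singleton]

theorem expVec_singleton_two (t : ℕ → K) :
    expVec t {2} = wedge K {2} + t 1 • wedge K {1} + (t 2 + 2⁻¹ * t 1 ^ 2) • wedge K {0} := by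
  have h1 : (Finset.Icc 1 2 : Finset ℕ) = {1, 2} := by decide
  simp [expVec, wt, Finset.sum_range_succ, pow_succ, ham_singleton, h1]
  module

theorem expVec_pair_one_two (t : ℕ → K) : expVec t {1, 2} =
    wedge K {1, 2} + t 1 • wedge K {0, 2} + (2⁻¹ * t 1 ^ 2 - t 2) • wedge K {0, 1} := by
  simp [expVec, wt, Finset.sum_range_succ, pow_succ, ham_pair_zero_one, ham_pair_zero_two,
    ham_pair_one_two]
  module

/-! ### Arbitrary weights -/

theorem sum_coeff_mul (s : Finset (Finset ℕ)) (g : Finset ℕ → K) (v : FinWedge K) :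
    ∑ S ∈ s, coeff S v * g S = lift (fun S => if S ∈ s then g S else 0) v := by
  have : ∑ S ∈ s, g S • coeff S = lift (K := K) (fun S => if S ∈ s then g S else 0) := by
    refine hom_ext fun T => ?_
    simp [lift_wedge, coeff_wedge]
  rw [← this]
  simp [mul_comm]

/-- Adding a row to a matched model constrains the weights of that row alone, with C and the
parameters of the lower rows as coefficients. -/
theorem ExpMatches.succ {W : ℕ → Weights K} {u : ℕ → ℕ → K} {C : ℕ → ℕ → ℕ → K}
    (h : ExpMatches W u C) (N M : ℕ) {lam mu : Finset ℕ} (hlam : lam ⊆ Finset.range (M + 1))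
    (hmu : mu ⊆ Finset.range (M + 1)) :
    C (N + 1) M lam.card * coeff mu (expVec (fun k => ∑ j ∈ Finset.range (N + 1), u j k) lam) =
      C N M lam.card * lift (fun kap => if kap ∈ (Finset.range (M + 1)).powerset then
        rowSum (W N) kap mu (M + 1) Spin.plus else 0)
          (expVec (fun k => ∑ j ∈ Finset.range N, u j k) lam) := by
  rw [← h (N + 1) M lam mu hlam hmu, Z_succ, ← sum_coeff_mul, Finset.mul_sum]
  refine Finset.sum_congr rfl fun kap hk => ?_
  rw [h N M lam kap hlam (Finset.mem_powerset.1 hk)]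
  ring

theorem ExpMatches.zero {W : ℕ → Weights K} {u : ℕ → ℕ → K} {C : ℕ → ℕ → ℕ → K}
    (h : ExpMatches W u C) {M l : ℕ} (hl : l ≤ M + 1) : C 0 M l = 1 := by
  have hs : Finset.range l ⊆ Finset.range (M + 1) := Finset.range_subset_range.2 hl
  have := h 0 M _ _ hs hs
  rw [Z_zero W hs hs, if_pos rfl, Finset.card_range] at this
  simp only [Finset.range_zero, Finset.sum_empty] at this
  have h0 : ham (fun _ => (0 : K)) = 0 := ham_zero
  rwa [expVec_of_ham_eq_zero (by rw [h0]; rfl), coeff_wedge, if_pos rfl, mul_one, eq_comm] at this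

/-- On two columns with one particle, the diagonal amplitude gives the ratio of consecutive C as
a₁b₁. If it were zero, then C would vanish for N + 1 rows, although the move from 1 to 0 still has
the nonzero contribution c₁c₂. -/
theorem ExpMatches.ne_zero {W : ℕ → Weights K} {u : ℕ → ℕ → K} {C : ℕ → ℕ → ℕ → K}
    (h : ExpMatches W u C) (hc : ∀ i, (W i).c₁ ≠ 0 ∧ (W i).c₂ ≠ 0) (N : ℕ) :
    (W N).a₁ ≠ 0 ∧ (W N).b₁ ≠ 0 := by
  have key : ∀ N, C N 1 1 ≠ 0 →
      C (N + 1) 1 1 = C N 1 1 * ((W N).b₁ * (W N).a₁) ∧ (W N).b₁ * (W N).a₁ ≠ 0 := by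
    intro N hN
    have h1 := h.succ N 1 (lam := {0}) (mu := {0}) (by decide) (by decide)
    have h2 := h.succ N 1 (lam := {1}) (mu := {0}) (by decide) (by decide)
    rw [expVec_of_ham_eq_zero (by simp [ham_singleton]),
      expVec_of_ham_eq_zero (by simp [ham_singleton])] at h1
    rw [expVec_singleton_one, expVec_singleton_one] at h2
    simp [lift_wedge, coeff_wedge, rowSum_succ_plus, rowSum_succ_minus, rowSum_zero] at h1 h2
    refine ⟨h1, fun h0 => ?_⟩
    rw [h1, h0, mul_zero, zero_mul, mul_zero, add_zero, eq_comm, mul_eq_zero, mul_eq_zero] at h2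
    rcases h2 with h2 | h2 | h2
    · exact hN h2
    · exact (hc N).2 h2
    · exact (hc N).1 h2
  have hC : ∀ N, C N 1 1 ≠ 0 := by
    intro N
    induction N with
    | zero => rw [h.zero (by omega)]; exact one_ne_zero
    | succ N ih => rw [(key N ih).1]; exact mul_ne_zero ih (key N ih).2
  exact ⟨right_ne_zero_of_mul (key N (hC N)).2, left_ne_zero_of_mul (key N (hC N)).2⟩

/-- For one row, the moves {2} → {1}, {2} → {0} and {1, 2} → {0, 1} have weights a₁c₁c₂, b₂c₁c₂ and
a₂c₁c₂, and amplitudes h₁ = t₁, h₂ = t₁²/2 + t₂ and e₂ = t₁²/2 - t₂. The diagonal elements eliminate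
C. -/
theorem ExpMatches.freeFermionic [CharZero K] {W : ℕ → Weights K} {u : ℕ → ℕ → K}
    {C : ℕ → ℕ → ℕ → K} (h : ExpMatches W u C) (hc : ∀ i, (W i).c₁ ≠ 0 ∧ (W i).c₂ ≠ 0) (N : ℕ) :
    (W N).FreeFermionic := by
  have key1 : ∀ N, C (N + 1) 2 1 = C N 2 1 * ((W N).b₁ * (W N).a₁ * (W N).a₁) := by
    intro N
    have h1 := h.succ N 2 (lam := {0}) (mu := {0}) (by decide) (by decide)
    rw [expVec_of_ham_eq_zero (by simp [ham_singleton]),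
      expVec_of_ham_eq_zero (by simp [ham_singleton])] at h1
    simpa [lift_wedge, coeff_wedge, rowSum_succ_plus, rowSum_succ_minus, rowSum_zero] using h1
  have key2 : ∀ N, C (N + 1) 2 2 = C N 2 2 * ((W N).b₁ * (W N).b₁ * (W N).a₁) := by
    intro N
    have h1 := h.succ N 2 (lam := {0, 1}) (mu := {0, 1}) (by decide) (by decide)
    rw [expVec_of_ham_eq_zero (ham_pair_zero_one _),
      expVec_of_ham_eq_zero (ham_pair_zero_one _)] at h1
    have h3 : ({0, 1} : Finset ℕ) ⊆ Finset.range 3 := by decide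
    simpa [lift_wedge, coeff_wedge, rowSum_succ_plus, rowSum_succ_minus, rowSum_zero, h3] using h1
  have hne : ∀ N, C N 2 1 ≠ 0 ∧ C N 2 2 ≠ 0 := by
    intro N
    induction N with
    | zero => simp [h.zero]
    | succ N ih =>
      obtain ⟨ha, hb⟩ := h.ne_zero hc N
      rw [key1, key2]
      exact ⟨mul_ne_zero ih.1 (mul_ne_zero (mul_ne_zero hb ha) ha),
        mul_ne_zero ih.2 (mul_ne_zero (mul_ne_zero hb hb) ha)⟩
  obtain ⟨ha, hb⟩ := h.ne_zero hc N
  have e1 := h.succ N 2 (lam := {2}) (mu := {1}) (by decide) (by decide)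
  have e2 := h.succ N 2 (lam := {2}) (mu := {0}) (by decide) (by decide)
  have e3 := h.succ N 2 (lam := {1, 2}) (mu := {0, 1}) (by decide) (by decide)
  have s1 : ({0, 1} : Finset ℕ) ⊆ Finset.range 3 := by decide
  have s2 : ({0, 2} : Finset ℕ) ⊆ Finset.range 3 := by decide
  have s3 : ({1, 2} : Finset ℕ) ⊆ Finset.range 3 := by decide
  have n1 : ({1, 2} : Finset ℕ) ≠ {0, 1} := by decide
  have n2 : ({0, 2} : Finset ℕ) ≠ {0, 1} := by decide
  rw [expVec_singleton_two, expVec_singleton_two] at e1 e2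
  rw [expVec_pair_one_two, expVec_pair_one_two] at e3
  generalize ∑ j ∈ Finset.range (N + 1), u j 1 = t₁' at e1 e2 e3
  generalize ∑ j ∈ Finset.range (N + 1), u j 2 = t₂' at e1 e2 e3
  generalize ∑ j ∈ Finset.range N, u j 1 = t₁ at e1 e2 e3
  generalize ∑ j ∈ Finset.range N, u j 2 = t₂ at e1 e2 e3
  simp [lift_wedge, coeff_wedge, rowSum_succ_plus, rowSum_succ_minus, rowSum_zero, key1] at e1 e2
  simp [lift_wedge, coeff_wedge, rowSum_succ_plus, rowSum_succ_minus, rowSum_zero, key2, s1, s2,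
    s3, n1, n2] at e3
  have e1' : (W N).a₁ * (W N).b₁ * t₁' =
      (W N).c₁ * (W N).c₂ + t₁ * ((W N).a₁ * (W N).b₁) :=
    mul_left_cancel₀ (mul_ne_zero (hne N).1 ha) (by linear_combination e1)
  have e2' := mul_left_cancel₀ (hne N).1 ((mul_assoc _ _ _).symm.trans e2)
  have e3' := mul_left_cancel₀ (hne N).2 ((mul_assoc _ _ _).symm.trans e3)
  -- This is h₁² = h₂ + e₂ with denominators cleared and c₁c₂ cancelled. The long factor of `e1'` is
  -- the sum of its two sides, so that the term is a difference of squares.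
  refine mul_left_cancel₀ (mul_ne_zero (hc N).1 (hc N).2) ?_
  linear_combination -(W N).b₁ * e2' - (W N).a₁ * e3' +
    ((W N).a₁ * (W N).b₁ * t₁' + (W N).c₁ * (W N).c₂ + t₁ * ((W N).a₁ * (W N).b₁)) * e1'

/-- The four weights a₁, a₂, b₁, b₂ determine x, y, A, B. The free fermion condition says that c₁c₂
is then the right product, and the separate values of c₁ and c₂ do not matter. -/
theorem exists_expMatches [CharZero K] {W : ℕ → Weights K}
    (h : ∀ i, (W i).a₁ ≠ 0 ∧ (W i).b₁ ≠ 0) (hW : ∀ i, (W i).FreeFermionic) :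
    ∃ u C, ExpMatches W u C := by
  refine ⟨_, _, (expMatches_gauge ?_ ?_ ?_ ?_ ?_ _ _).2 (expMatches_weights
    (fun i => (W i).b₂ / (W i).a₁) (fun i => (W i).a₂ / (W i).b₁) (fun i => (W i).a₁)
    (fun i => (W i).b₁ / (W i).a₁)
    (u := fun j k => (((W j).b₂ / (W j).a₁) ^ k +
      (-1) ^ (k - 1) * ((W j).a₂ / (W j).b₁) ^ k) / k) fun _ _ _ => rfl)⟩ <;>
  intro i <;> obtain ⟨ha, hb⟩ := h i <;> have hi := hW i <;>
    simp only [weights, Weights.FreeFermionic] at hi ⊢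
  · field_simp
  · field_simp
  · field_simp
  · field_simp
    linear_combination -hi

theorem expMatches_iff_freeFermionic [CharZero K] {W : ℕ → Weights K}
    (hc : ∀ i, (W i).c₁ ≠ 0 ∧ (W i).c₂ ≠ 0) (h : ∀ i, (W i).a₁ ≠ 0 ∧ (W i).b₁ ≠ 0) :
    (∃ u C, ExpMatches W u C) ↔ ∀ i, (W i).FreeFermionic :=
  ⟨fun ⟨_, _, hu⟩ => hu.freeFermionic hc, exists_expMatches h⟩

theorem Weights.freeFermionic_swap (w : Weights K) :
    w.swap.FreeFermionic ↔ w.FreeFermionic := by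
  simp only [Weights.FreeFermionic, Weights.swap, mul_comm w.c₂]

/-- After the swap, the dual weights are those of 𝔖(y, x, A⁻¹, B⁻¹) up to rescaling c₁ and c₂, which
explains the exchange of x and y. -/
theorem dualMatches_dualWeights_iff [CharZero K] (x y A B : ℕ → K) (s : ℕ → ℤ → K)
    (h : ∀ i, A i ≠ 0 ∧ B i ≠ 0) :
    DualMatches (dualWeights x y A B) s (fun N M l => (factor A B N M l)⁻¹) ↔
      ∀ j, ∀ k : ℕ, 1 ≤ k → s j (-k) = (y j ^ k + (-1) ^ (k - 1) * x j ^ k) / k := by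
  have hf : (fun N M l => (factor A B N M l)⁻¹) =
      factor (fun i => (A i)⁻¹) (fun i => (B i)⁻¹) := by
    funext N M l
    simp only [factor, ← Finset.prod_inv_distrib, mul_inv, inv_pow]
  rw [dualMatches_iff, hf, ← expMatches_weights_iff y x (fun i => (A i)⁻¹) (fun i => (B i)⁻¹)
    (fun j k => s j (-k)) fun i => ⟨inv_ne_zero (h i).1, inv_ne_zero (h i).2⟩]
  refine expMatches_gauge (W := fun i => (dualWeights x y A B i).swap)
    (W' := weights y x (fun i => (A i)⁻¹) fun i => (B i)⁻¹) (fun _ => rfl) (fun _ => rfl)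
    (fun _ => rfl) (fun _ => rfl) (fun i => ?_) _ _
  simp only [Weights.swap, dualWeights, weights]
  ring

end Matching
end SixVertex

end

open SixVertex in
theorem theorem4p1 {K : Type*} [Field K] [CharZero K] :
    -- the model with weights `𝔖(x, y, A, B)`
    (∀ (x y A B : ℕ → K) (s : ℕ → ℤ → K),
      ((∀ j, ∀ k : ℕ, 1 ≤ k → s j k = (x j ^ k + (-1) ^ (k - 1) * y j ^ k) / k) →
        Matches (weights x y A B) s (factor A B)) ∧
      ((∀ i, A i ≠ 0 ∧ B i ≠ 0) →
        (Matches (weights x y A B) s (factor A B) ↔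
          ∀ j, ∀ k : ℕ, 1 ≤ k → s j k = (x j ^ k + (-1) ^ (k - 1) * y j ^ k) / k))) ∧
    -- the model with arbitrary weights
    (∀ W : ℕ → Weights K, (∀ i, (W i).c₁ ≠ 0 ∧ (W i).c₂ ≠ 0) →
      ((¬ ∀ i, (W i).FreeFermionic) → ∀ s C, ¬ Matches W s C) ∧
      ((∀ i, (W i).a₁ ≠ 0 ∧ (W i).b₁ ≠ 0) →
        ((∃ s C, Matches W s C) ↔ ∀ i, (W i).FreeFermionic))) ∧
    -- the dual model with weights `𝔖*(x, y, A, B)`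
    (∀ (x y A B : ℕ → K) (s : ℕ → ℤ → K), (∀ i, A i ≠ 0 ∧ B i ≠ 0) →
      (DualMatches (dualWeights x y A B) s (fun N M l => (factor A B N M l)⁻¹) ↔
        ∀ j, ∀ k : ℕ, 1 ≤ k → s j (-k) = (y j ^ k + (-1) ^ (k - 1) * x j ^ k) / k)) ∧
    -- the dual model with arbitrary weights
    (∀ W : ℕ → Weights K, (∀ i, (W i).c₁ ≠ 0 ∧ (W i).c₂ ≠ 0) →
      ((¬ ∀ i, (W i).FreeFermionic) → ∀ s C, ¬ DualMatches W s C) ∧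
      ((∀ i, (W i).a₁ ≠ 0 ∧ (W i).b₁ ≠ 0) →
        ((∃ s C, DualMatches W s C) ↔ ∀ i, (W i).FreeFermionic))) := by
  refine ⟨fun x y A B s => ⟨fun hs => ?_, fun h => ?_⟩, fun W hc => ⟨fun hW s C h => hW ?_,
    fun h => ?_⟩, fun x y A B s h => dualMatches_dualWeights_iff x y A B s h,
    fun W hc => ⟨fun hW s C h => hW fun i => ?_, fun h => ?_⟩⟩
  · exact (matches_iff _ _ _).2 (expMatches_weights x y A B hs)
  · rw [matches_iff, expMatches_weights_iff x y A B _ h]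
  · exact ((matches_iff W s C).1 h).freeFermionic hc
  · rw [← expMatches_iff_freeFermionic hc h]
    constructor
    · rintro ⟨s, C, hs⟩
      exact ⟨_, C, (matches_iff W s C).1 hs⟩
    -- Only one sign of k enters each condition, so the values at the other sign are arbitrary.
    · rintro ⟨u, C, hu⟩
      exact ⟨fun j k => u j k.natAbs, C, (matches_iff W _ C).2 (by simpa using hu)⟩
  · exact (W i).freeFermionic_swap.1
      (((dualMatches_iff W s C).1 h).freeFermionic (fun i => (hc i).symm) i)
  · rw [← forall_congr' fun i => (W i).freeFermionic_swap,
      ← expMatches_iff_freeFermionic (W := fun i => (W i).swap) (fun i => (hc i).symm) h]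
    constructor
    · rintro ⟨s, C, hs⟩
      exact ⟨_, C, (dualMatches_iff W s C).1 hs⟩
    · rintro ⟨u, C, hu⟩
      exact ⟨fun j k => u j k.natAbs, C, (dualMatches_iff W _ C).2 (by simpa using hu)⟩
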